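/- Let $\ell,T,C_g>0$. Let $\rho,\mu\in L^\infty(0,\ell)$ and $r,\kappa\in H^2(0,\ell)$ satisfy, for constants $\rho_0,\rho_1,\mu_0,\mu_1,r_0,r_1,\kappa_0,\kappa_1$, $$0<\rho_0\le\rho(x)\le\rho_1,\quad 0\le\mu_0\le\mu(x)\le\mu_1,\quad 0<r_0\le r(x)\le r_1,\quad 0<\kappa_0\le\kappa(x)\le\kappa_1$$ on $(0,\ell)$ (almost everywhere for $\rho,\mu$). Put $\mathcal V=\{v\in H^2(0,\ell): v(0)=v_x(0)=0\}$ with the $H^2$-norm, and $$\mathcal G_1=\{g\in H^1(0,T): g(0)=0,\ \|g\|_{H^1(0,T)}\le C_g\}.$$ For $g\in\mathcal G_1$, a weak solution $u=u(\cdot,\cdot;g)$ of the beam problem $$\rho u_{tt}+\mu u_t+(ru_{xx})_{xx}+(\kappa u_{xxt})_{xx}=0\ \text{ in }(0,\ell)\times(0,T),\qquad u|_{t=0}=u_t|_{t=0}=0,\qquad u|_{x=0}=u_x|_{x=0}=0,$$ $$[ru_{xx}+\kappa u_{xxt}]_{x=\ell}=0,\qquad -[(ru_{xx}+\kappa u_{xxt})_x]_{x=\ell}=g$$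 is a function $u\in L^2(0,T;\mathcal V)$ with $u_t\in L^2(0,T;\mathcal V)$, $u_{tt}\in L^2(0,T;L^2(0,\ell))$, $u(0)=0$, $u_t(0)=0$, such that for every $v\in\mathcal V$ and almost every $t\in(0,T)$ $$\int_0^\ell\big(\rho u_{tt}(t)v+\mu u_t(t)v+ru_{xx}(t)v_{xx}+\kappa u_{xxt}(t)v_{xx}\big)\,dx=g(t)v(\ell).$$ Let $\nu,\omega\in L^2(0,T)$. Then: 1. For every $g\in\mathcal G_1$ there is exactly one weak solution $u(\cdot,\cdot;g)$; for almost every $t$ the functions $u(\cdot,t;g)$, $u_{xx}(\cdot,t;g)$ and $u_{xxt}(\cdot,t;g)$ have representatives that are continuous on $[0,\ell]$; and, with point values taken from these representatives, the outputs $$(\Phi g)(t)=u(\ell,t;g),\qquad (\Psi g)(t)=-\big(r(0)u_{xx}(0,t;g)+\kappa(0)u_{xxt}(0,t;g)\big)$$ belong to $L^2(0,T)$. In particular the functionals $$J_1(g)=\tfrac12\|\Phi g-\nu\|_{L^2(0,T)}^2,\qquad J_2(g)=\tfrac12\|\Psi g-\omega\|_{L^2(0,T)}^2$$ are well defined on $\mathcal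 G_1$. 2. There is a $g\in\mathcal G_1$ with $J_1(g)=\min_{\mathcal G_1}J_1$. 3. There is a $g\in\mathcal G_1$ with $J_2(g)=\min_{\mathcal G_1}J_2$. -/

import Mathlib

open MeasureTheory Set
open scoped ENNReal

noncomputable section

namespace Beam

/-- The space `L²(0,b)`. -/
abbrev L2 (b : ℝ) : Type := Lp ℝ 2 (volume.restrict (Ioo (0 : ℝ) b))

/-- `f` is (the continuous representative of) an element of `H¹(0,b;E)` with weak derivative
`f'`: it is absolutely continuous on `[0,b]`, being the primitive of `f' ∈ L²(0,b;E)`. -/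
def HasL2Deriv {E : Type*} [NormedAddCommGroup E] [NormedSpace ℝ E]
    (b : ℝ) (f f' : ℝ → E) : Prop :=
  MemLp f' 2 (volume.restrict (Ioo (0 : ℝ) b)) ∧
    ∀ x ∈ Icc (0 : ℝ) b, f x = f 0 + ∫ y in (0 : ℝ)..x, f' y

/-- The a.e.-class of `f` belongs to `H¹(0,b;E)`, its weak derivative is `f'`, and its continuous
representative takes the value `c` at `0`. -/
def HasWeakDerivFrom {E : Type*} [NormedAddCommGroup E] [NormedSpace ℝ E]
    (b : ℝ) (c : E) (f f' : ℝ → E) : Prop :=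
  ∃ F : ℝ → E, HasL2Deriv b F f' ∧ F 0 = c ∧ f =ᵐ[volume.restrict (Ioo (0 : ℝ) b)] F

/-- `f` is the continuous representative of an element of `H²(0,b)`. -/
def MemH2 (b : ℝ) (f : ℝ → ℝ) : Prop :=
  ∃ f' f'' : ℝ → ℝ, HasL2Deriv b f f' ∧ HasL2Deriv b f' f''

/-- `F` is a representative, continuous on `[0,b]`, of the a.e.-class of `f`. -/
def IsContRep (b : ℝ) (f F : ℝ → ℝ) : Prop :=
  ContinuousOn F (Icc (0 : ℝ) b) ∧ f =ᵐ[volume.restrict (Ioo (0 : ℝ) b)] F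

open Classical in
/-- The trace `f(x)`, `x ∈ [0,b]`, of an a.e.-class on `(0,b)`: the value at `x` of its continuous
representative (and `0` if there is none). -/
def trace (b : ℝ) (f : ℝ → ℝ) (x : ℝ) : ℝ :=
  if h : ∃ F, IsContRep b f F then h.choose x else 0

lemma HasWeakDerivFrom.zero_iff {b : ℝ} (f f' : L2 b) :
    HasWeakDerivFrom b 0 f f' ↔
      ∀ᵐ x ∂(volume.restrict (Ioo (0 : ℝ) b)), f x = ∫ y in (0 : ℝ)..x, f' y := by
  constructor
  · rintro ⟨F, ⟨_, hF⟩, h0, hf⟩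
    filter_upwards [hf, ae_restrict_mem measurableSet_Ioo] with x hx hxm
    rw [hx, hF x ⟨hxm.1.le, hxm.2.le⟩, h0, zero_add]
  · intro h
    exact ⟨fun x => ∫ y in (0 : ℝ)..x, f' y, ⟨Lp.memLp f', fun x _ => by simp⟩, by simp, h⟩

lemma HasWeakDerivFrom.add {b : ℝ} {f f' g g' : L2 b}
    (hf : HasWeakDerivFrom b 0 f f') (hg : HasWeakDerivFrom b 0 g g') :
    HasWeakDerivFrom b 0 (f + g : L2 b) (f' + g' : L2 b) := by
  rw [HasWeakDerivFrom.zero_iff] at *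
  filter_upwards [hf, hg, Lp.coeFn_add f g, ae_restrict_mem measurableSet_Ioo]
    with x hfx hgx hx hxm
  have hsub : Ioc (0 : ℝ) x ⊆ Ioo 0 b := fun y hy => ⟨hy.1, hy.2.trans_lt hxm.2⟩
  have hle : volume.restrict (Ioc (0 : ℝ) x) ≤ volume.restrict (Ioo (0 : ℝ) b) :=
    Measure.restrict_mono hsub le_rfl
  have hint : ∀ h : L2 b, Integrable h (volume.restrict (Ioc (0 : ℝ) x)) := fun h =>
    (((Lp.memLp h).integrable (by norm_num))).mono_measure hle
  rw [hx, Pi.add_apply, hfx, hgx, intervalIntegral.integral_of_le hxm.1.le,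
    intervalIntegral.integral_of_le hxm.1.le, intervalIntegral.integral_of_le hxm.1.le,
    ← integral_add (hint f') (hint g')]
  refine integral_congr_ae ?_
  filter_upwards [ae_mono hle (Lp.coeFn_add f' g')] with y hy
  rw [hy, Pi.add_apply]

lemma HasWeakDerivFrom.smul {b : ℝ} {f f' : L2 b} (c : ℝ)
    (hf : HasWeakDerivFrom b 0 f f') :
    HasWeakDerivFrom b 0 (c • f : L2 b) (c • f' : L2 b) := by
  rw [HasWeakDerivFrom.zero_iff] at *
  filter_upwards [hf, Lp.coeFn_smul c f, ae_restrict_mem measurableSet_Ioo] with x hfx hx hxm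
  have hsub : Ioc (0 : ℝ) x ⊆ Ioo 0 b := fun y hy => ⟨hy.1, hy.2.trans_lt hxm.2⟩
  have hle : volume.restrict (Ioc (0 : ℝ) x) ≤ volume.restrict (Ioo (0 : ℝ) b) :=
    Measure.restrict_mono hsub le_rfl
  rw [hx, Pi.smul_apply, hfx, intervalIntegral.integral_of_le hxm.1.le,
    intervalIntegral.integral_of_le hxm.1.le, ← integral_smul]
  refine integral_congr_ae ?_
  filter_upwards [ae_mono hle (Lp.coeFn_smul c f')] with y hy
  rw [hy, Pi.smul_apply]

lemma HasWeakDerivFrom.zero {b : ℝ} :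
    HasWeakDerivFrom b 0 (0 : L2 b) (0 : L2 b) := by
  have h := HasWeakDerivFrom.zero_iff (0 : L2 b) (0 : L2 b)
  rw [h]
  filter_upwards [Lp.coeFn_zero ℝ 2 (volume.restrict (Ioo (0 : ℝ) b)),
    ae_restrict_mem measurableSet_Ioo] with x hx hxm
  have hsub : Ioc (0 : ℝ) x ⊆ Ioo 0 b := fun y hy => ⟨hy.1, hy.2.trans_lt hxm.2⟩
  have hle : volume.restrict (Ioc (0 : ℝ) x) ≤ volume.restrict (Ioo (0 : ℝ) b) :=
    Measure.restrict_mono hsub le_rfl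
  rw [hx, Pi.zero_apply, intervalIntegral.integral_of_le hxm.1.le, eq_comm]
  refine integral_eq_zero_of_ae ?_
  filter_upwards [ae_mono hle (Lp.coeFn_zero ℝ 2 (volume.restrict (Ioo (0 : ℝ) b)))] with y hy
  rw [hy]

lemma HasWeakDerivFrom.of_tendsto {b : ℝ} {f f' : ℕ → L2 b} {g g' : L2 b}
    (h : ∀ n, HasWeakDerivFrom b 0 (f n) (f' n))
    (hf : Filter.Tendsto f Filter.atTop (nhds g))
    (hf' : Filter.Tendsto f' Filter.atTop (nhds g')) :
    HasWeakDerivFrom b 0 g g' := by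
  rw [HasWeakDerivFrom.zero_iff]
  obtain ⟨ns, hns, hlim⟩ := (tendstoInMeasure_of_tendsto_Lp hf).exists_seq_tendsto_ae
  have hall := ae_all_iff.2 fun n => (HasWeakDerivFrom.zero_iff (f n) (f' n)).1 (h n)
  filter_upwards [hlim, hall, ae_restrict_mem measurableSet_Ioo] with x hx hn hxm
  have hsub : Ioc (0 : ℝ) x ⊆ Ioo 0 b := fun y hy => ⟨hy.1, hy.2.trans_lt hxm.2⟩
  have hfin : (volume.restrict (Ioo (0 : ℝ) b)) (Ioc 0 x) ≠ ∞ := measure_ne_top _ _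
  have key : ∀ k : L2 b, ∫ y in (0 : ℝ)..x, k y
      = inner ℝ (indicatorConstLp 2 measurableSet_Ioc hfin (1 : ℝ)) k := by
    intro k
    rw [L2.inner_indicatorConstLp_one, Measure.restrict_restrict measurableSet_Ioc,
      inter_eq_self_of_subset_left hsub, intervalIntegral.integral_of_le hxm.1.le]
  refine tendsto_nhds_unique hx ?_
  simp only [hn, key]
  exact (tendsto_const_nhds.inner hf').comp hns.tendsto_atTop

/-- The space `{v ∈ H²(0,ℓ) : v(0) = v_x(0) = 0}`, an element `v` being recorded as the triple
`(v, v_x, v_xx)` in `L²(0,ℓ)³`. Its norm is the standard one,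
`(∫ v² + v_x² + v_xx²)^(1/2)`. -/
def V (ℓ : ℝ) : Submodule ℝ (PiLp 2 fun _ : Fin 3 => L2 ℓ) where
  carrier := {p | HasWeakDerivFrom ℓ 0 (p 0) (p 1) ∧ HasWeakDerivFrom ℓ 0 (p 1) (p 2)}
  add_mem' := fun hp hq => ⟨hp.1.add hq.1, hp.2.add hq.2⟩
  zero_mem' := ⟨HasWeakDerivFrom.zero, HasWeakDerivFrom.zero⟩
  smul_mem' := fun c _ hp => ⟨hp.1.smul c, hp.2.smul c⟩

/-- Completeness of the space, so that Bochner integrals with values in it make sense. -/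
instance V.completeSpace (ℓ : ℝ) : CompleteSpace (V ℓ) := by
  refine IsClosed.completeSpace_coe (hs := ?_)
  refine IsSeqClosed.isClosed fun p q hp hq => ?_
  have hc : ∀ i : Fin 3, Filter.Tendsto (fun n => p n i) Filter.atTop (nhds (q i)) := fun i =>
    ((PiLp.continuous_apply 2 (fun _ : Fin 3 => L2 ℓ) i).tendsto q).comp hq
  exact ⟨HasWeakDerivFrom.of_tendsto (fun n => (hp n).1) (hc 0) (hc 1),
    HasWeakDerivFrom.of_tendsto (fun n => (hp n).2) (hc 1) (hc 2)⟩

/-- The function `v` itself, as an element of `L²(0,ℓ)`. -/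
def fn {ℓ : ℝ} (v : V ℓ) : L2 ℓ := (v : PiLp 2 fun _ : Fin 3 => L2 ℓ) 0

/-- The second derivative `v_xx`. -/
def dxx {ℓ : ℝ} (v : V ℓ) : L2 ℓ := (v : PiLp 2 fun _ : Fin 3 => L2 ℓ) 2

/-- The basic assumptions on the coefficients; `r` and `κ`, as elements of `H²(0,ℓ)`, are given
by their continuous representatives. -/
structure Coefficients (ℓ ρ₀ ρ₁ μ₀ μ₁ r₀ r₁ κ₀ κ₁ : ℝ) (ρ μ r κ : ℝ → ℝ) : Prop where
  ρ_meas : AEStronglyMeasurable ρ (volume.restrict (Ioo 0 ℓ))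
  μ_meas : AEStronglyMeasurable μ (volume.restrict (Ioo 0 ℓ))
  r_mem : MemH2 ℓ r
  κ_mem : MemH2 ℓ κ
  ρ₀_pos : 0 < ρ₀
  ρ_bounds : ∀ᵐ x ∂(volume.restrict (Ioo 0 ℓ)), ρ₀ ≤ ρ x ∧ ρ x ≤ ρ₁
  μ₀_nonneg : 0 ≤ μ₀
  μ_bounds : ∀ᵐ x ∂(volume.restrict (Ioo 0 ℓ)), μ₀ ≤ μ x ∧ μ x ≤ μ₁
  r₀_pos : 0 < r₀
  r_bounds : ∀ x ∈ Icc 0 ℓ, r₀ ≤ r x ∧ r x ≤ r₁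
  κ₀_pos : 0 < κ₀
  κ_bounds : ∀ x ∈ Icc 0 ℓ, κ₀ ≤ κ x ∧ κ x ≤ κ₁

/-- The admissible shear forces
`{g ∈ H¹(0,T) : g(0) = 0, ‖g‖_{H¹(0,T)} ≤ C}`, as a subset of `L²(0,T)`. -/
def admissible (T C : ℝ) : Set (L2 T) :=
  {g | ∃ g' : L2 T, HasWeakDerivFrom T 0 g g' ∧ Real.sqrt (‖g‖ ^ 2 + ‖g'‖ ^ 2) ≤ C}

/-- A function `u ∈ L²(0,T;V)` with candidates for its time derivatives
`u_t ∈ L²(0,T;V)` and `u_tt ∈ L²(0,T;L²(0,ℓ))`. -/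
abbrev Evolution (ℓ T : ℝ) : Type :=
  Lp (V ℓ) 2 (volume.restrict (Ioo (0 : ℝ) T)) ×
  Lp (V ℓ) 2 (volume.restrict (Ioo (0 : ℝ) T)) ×
  Lp (L2 ℓ) 2 (volume.restrict (Ioo (0 : ℝ) T))

/-- `s = (u, u_t, u_tt)`, where `u` is a weak solution of the damped cantilever beam equation
`ρ u_tt + μ u_t + (r u_xx)_xx + (κ u_xxt)_xx = 0` with `u(x,0) = u_t(x,0) = 0`,
`u(0,t) = u_x(0,t) = 0`, `[r u_xx + κ u_xxt]_{x=ℓ} = 0`, `-[(r u_xx + κ u_xxt)_x]_{x=ℓ} = g`. -/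
structure IsWeakSolution (ℓ T : ℝ) (ρ μ r κ : ℝ → ℝ) (g : L2 T) (s : Evolution ℓ T) : Prop where
  /-- `u ∈ H¹(0,T;V)` has time derivative `u_t`, and `u(0) = 0`. -/
  deriv_u : HasWeakDerivFrom T 0 s.1 s.2.1
  /-- `u_t ∈ H¹(0,T;L²(0,ℓ))` has time derivative `u_tt`, and `u_t(0) = 0`. -/
  deriv_ut : HasWeakDerivFrom T 0 (fun t => fn (s.2.1 t)) s.2.2
  weak_form : ∀ v : V ℓ, ∀ᵐ t ∂(volume.restrict (Ioo 0 T)),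
    (∫ x in Ioo 0 ℓ, ρ x * s.2.2 t x * fn v x) +
    (∫ x in Ioo 0 ℓ, μ x * fn (s.2.1 t) x * fn v x) +
    (∫ x in Ioo 0 ℓ, r x * dxx (s.1 t) x * dxx v x) +
    (∫ x in Ioo 0 ℓ, κ x * dxx (s.2.1 t) x * dxx v x) = g t * trace ℓ (fn v) ℓ

/-- The weak solution `u(·,·;g)` together with `u_t` and `u_tt`
(a junk value if there is no weak solution). -/
def solution (ℓ T : ℝ) (ρ μ r κ : ℝ → ℝ) (g : L2 T) : Evolution ℓ T :=
  Classical.epsilon (IsWeakSolution ℓ T ρ μ r κ g)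

/-- The Neumann-to-Dirichlet operator `(Φ g)(t) = u(ℓ,t;g)`. -/
def Phi (ℓ T : ℝ) (ρ μ r κ : ℝ → ℝ) (g : L2 T) (t : ℝ) : ℝ :=
  trace ℓ (fn ((solution ℓ T ρ μ r κ g).1 t)) ℓ

/-- The Neumann-to-Neumann operator
`(Ψ g)(t) = -(r(0) u_xx(0,t;g) + κ(0) u_xxt(0,t;g))`. -/
def Psi (ℓ T : ℝ) (ρ μ r κ : ℝ → ℝ) (g : L2 T) (t : ℝ) : ℝ :=
  -(r 0 * trace ℓ (dxx ((solution ℓ T ρ μ r κ g).1 t)) 0 +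
    κ 0 * trace ℓ (dxx ((solution ℓ T ρ μ r κ g).2.1 t)) 0)

/-- `J₁(g) = ½ ‖Φ g - ν‖²_{L²(0,T)}`. -/
def J1 (ℓ T : ℝ) (ρ μ r κ : ℝ → ℝ) (ν : L2 T) (g : L2 T) : ℝ :=
  1 / 2 * ∫ t in Ioo 0 T, (Phi ℓ T ρ μ r κ g t - ν t) ^ 2

/-- `J₂(g) = ½ ‖Ψ g - ω‖²_{L²(0,T)}`. -/
def J2 (ℓ T : ℝ) (ρ μ r κ : ℝ → ℝ) (ω : L2 T) (g : L2 T) : ℝ :=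
  1 / 2 * ∫ t in Ioo 0 T, (Psi ℓ T ρ μ r κ g t - ω t) ^ 2

end Beam

end

open scoped BoundedContinuousFunction

set_option linter.unusedSectionVars false

noncomputable section

namespace Beam

-- Since `v(0) = v_x(0) = 0`, an element of `V` is determined by `v_xx`, so the problem can be posed
-- in `L²(0,T;L²(0,ℓ))`. Write `ζ = u_xxtt` and `∂ₜ⁻¹` for integration from `0`. The weak equation
-- becomes `P ζ + Q ∂ₜ⁻¹ζ + R ∂ₜ⁻²ζ = g ⊗ (ℓ - x)`, where `P` carries the inertia, `Q` is
-- multiplication by `κ` plus the `μ` term, and `R` is multiplication by `r`. All three are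
-- symmetric, `P` and `R` are nonnegative, and `Q ≥ κ₀`.
--
-- Existence: an admissible load is `g = ∂ₜ⁻¹h`, so the right-hand side lies in the range of `∂ₜ⁻¹`.
-- Testing the adjoint equation with the backward primitive of the test function gives
-- `evolOp_adjoint_bound`, and Douglas factorisation then produces a bounded solution operator `D :
-- h ↦ ζ`. Uniqueness is the energy identity tested with `u_t`, in the full class of weak solutions
-- (`eq_zero_of_beamOp_eq_zero`).
--
-- Traces: integrating the equation in space shows that the moment `r u_xx + κ u_xxt` is a tail
-- integral, hence continuous in `x`. Recovering `u_xxt` from it is a Volterra equation in time,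
-- solvable among functions of `t` with values in the bounded continuous functions of `x`
-- (`isUnit_one_add_volterra`). Uniqueness in `L²` identifies the two solutions
-- (`exists_continuous_solution`), and evaluating the moment at `0` gives `Ψ`.
--
-- Minimisation: both outputs are therefore bounded linear functions of `h = g'`, and the admissible
-- `h` form a bounded closed convex set. A linear least squares problem on such a set has a
-- minimiser (`exists_isMinOn_norm_sub`).

local notation "vol[" b "]" => volume.restrict (Ioo (0 : ℝ) b)

/-! ### Integration as a bounded operator on vector-valued `L²`. -/

section Primitive

variable {E F : Type*} [NormedAddCommGroup E] [NormedSpace ℝ E] [NormedAddCommGroup F]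
  [NormedSpace ℝ F] {b : ℝ}

lemma integrable_of_L2 (f : Lp E 2 vol[b]) : Integrable f vol[b] :=
  (Lp.memLp f).integrable (by norm_num)

lemma norm_integral_norm_le (f : Lp E 2 vol[b]) :
    ∫ x, ‖f x‖ ∂vol[b] ≤ (max b 0) ^ (1 / 2 : ℝ) * ‖f‖ := by
  have h1 : ENNReal.ofReal (∫ x, ‖f x‖ ∂vol[b]) = eLpNorm f 1 vol[b] := by
    rw [eLpNorm_one_eq_lintegral_enorm, ofReal_integral_norm_eq_lintegral_enorm (integrable_of_L2 f)]
  have h2 := eLpNorm_le_eLpNorm_mul_rpow_measure_univ (μ := vol[b]) (p := 1) (q := 2)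
    (by norm_num) (Lp.aestronglyMeasurable f)
  rw [← h1, Measure.restrict_apply_univ, Real.volume_Ioo] at h2
  have h3 := ENNReal.toReal_mono
    (ENNReal.mul_ne_top (Lp.eLpNorm_lt_top f).ne (by norm_num)) h2
  rw [ENNReal.toReal_ofReal (by positivity), ENNReal.toReal_mul, ← ENNReal.toReal_rpow,
    ENNReal.toReal_ofReal', ← Lp.norm_def] at h3
  convert h3 using 1
  norm_num
  ring

/-- The primitive `t ↦ ∫₀ᵗ f` of a square integrable function. -/
def primitive (f : Lp E 2 vol[b]) (t : ℝ) : E := ∫ y in (0 : ℝ)..t, f y ∂vol[b]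

/-- Integrating against the restricted measure makes the primitive continuous on all of `ℝ`; on
`[0,b]` this agrees with the usual one. -/
lemma primitive_eq (f : Lp E 2 vol[b]) {t : ℝ} (ht : t ∈ Icc 0 b) :
    primitive f t = ∫ y in (0 : ℝ)..t, f y := by
  rw [primitive, intervalIntegral.integral_of_le ht.1, intervalIntegral.integral_of_le ht.1,
    integral_Ioc_eq_integral_Ioo, integral_Ioc_eq_integral_Ioo, Measure.restrict_restrict measurableSet_Ioo,
    inter_eq_self_of_subset_left (Ioo_subset_Ioo_right ht.2)]

lemma primitive_zero_apply (f : Lp E 2 vol[b]) : primitive f 0 = 0 := by simp [primitive]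

lemma continuous_primitive (f : Lp E 2 vol[b]) : Continuous (primitive f) :=
  intervalIntegral.continuous_primitive
    (fun _ _ => (integrable_of_L2 f).intervalIntegrable) 0

lemma norm_primitive_le (f : Lp E 2 vol[b]) {t : ℝ} (ht : 0 ≤ t) :
    ‖primitive f t‖ ≤ ∫ x, ‖f x‖ ∂vol[b] := by
  rw [primitive, intervalIntegral.integral_of_le ht]
  refine (norm_integral_le_integral_norm _).trans ?_
  exact setIntegral_le_integral (integrable_of_L2 f).norm (ae_of_all _ fun _ => norm_nonneg _)

lemma primitive_add (f g : Lp E 2 vol[b]) : primitive (f + g) = primitive f + primitive g := by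
  ext t
  rw [Pi.add_apply, primitive, primitive, primitive, ← intervalIntegral.integral_add
    (integrable_of_L2 f).intervalIntegrable (integrable_of_L2 g).intervalIntegrable]
  refine intervalIntegral.integral_congr_ae ?_
  filter_upwards [Lp.coeFn_add f g] with x hx _ using hx

lemma primitive_smul (c : ℝ) (f : Lp E 2 vol[b]) : primitive (c • f) = c • primitive f := by
  ext t
  rw [Pi.smul_apply, primitive, primitive, ← intervalIntegral.integral_smul]
  refine intervalIntegral.integral_congr_ae ?_
  filter_upwards [Lp.coeFn_smul c f] with x hx _ using hx

lemma ae_norm_primitive_le (f : Lp E 2 vol[b]) :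
    ∀ᵐ t ∂vol[b], ‖primitive f t‖ ≤ ∫ x, ‖f x‖ ∂vol[b] := by
  filter_upwards [ae_restrict_mem measurableSet_Ioo] with t ht
  exact norm_primitive_le f ht.1.le

lemma memLp_primitive (f : Lp E 2 vol[b]) : MemLp (primitive f) 2 vol[b] :=
  MemLp.of_bound (continuous_primitive f).aestronglyMeasurable _ (ae_norm_primitive_le f)

variable (E b) in
/-- The integration operator `f ↦ ∫₀ᵗ f` on `L²(0,b;E)`. -/
def prim : Lp E 2 vol[b] →L[ℝ] Lp E 2 vol[b] :=
  LinearMap.mkContinuous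
    { toFun := fun f => (memLp_primitive f).toLp
      map_add' := fun f g => by
        rw [← MemLp.toLp_add]; congr 1; exact primitive_add f g
      map_smul' := fun c f => by
        rw [RingHom.id_apply, ← MemLp.toLp_const_smul]; congr 1; exact primitive_smul c f }
    ((vol[b]).real univ ^ (2 : ℝ≥0∞).toReal⁻¹ * (max b 0) ^ (1 / 2 : ℝ)) (fun f => by
      have h0 : 0 ≤ ∫ x, ‖f x‖ ∂vol[b] := integral_nonneg fun _ => norm_nonneg _
      refine (Lp.norm_le_of_ae_bound (C := ∫ x, ‖f x‖ ∂vol[b]) h0 ?_).trans ?_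
      · filter_upwards [(memLp_primitive f).coeFn_toLp, ae_norm_primitive_le f] with t h1 h2
        exact (congrArg norm h1).trans_le h2
      · rw [mul_assoc]
        have := norm_integral_norm_le f
        simp only [measureUnivNNReal]
        gcongr
        exact le_rfl)

lemma coeFn_prim (f : Lp E 2 vol[b]) : prim E b f =ᵐ[vol[b]] primitive f :=
  (memLp_primitive f).coeFn_toLp

lemma coeFn_prim_integral (f : Lp E 2 vol[b]) :
    prim E b f =ᵐ[vol[b]] fun t => ∫ y in (0 : ℝ)..t, f y := by
  filter_upwards [coeFn_prim f, ae_restrict_mem measurableSet_Ioo] with t h1 h2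
  rw [h1, primitive_eq f ⟨h2.1.le, h2.2.le⟩]

lemma hasWeakDerivFrom_zero_iff (f : ℝ → E) (f' : Lp E 2 vol[b]) :
    HasWeakDerivFrom b 0 f f' ↔ f =ᵐ[vol[b]] prim E b f' := by
  constructor
  · rintro ⟨F, ⟨_, hF⟩, h0, hf⟩
    filter_upwards [hf, coeFn_prim_integral f', ae_restrict_mem measurableSet_Ioo] with x hx h1 hxm
    rw [hx, hF x ⟨hxm.1.le, hxm.2.le⟩, h0, zero_add, h1]
  · intro h
    exact ⟨fun x => ∫ y in (0 : ℝ)..x, f' y, ⟨Lp.memLp f', fun x _ => by simp⟩, by simp,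
      h.trans (coeFn_prim_integral f')⟩

lemma hasWeakDerivFrom_Lp_iff (f f' : Lp E 2 vol[b]) :
    HasWeakDerivFrom b 0 f f' ↔ f = prim E b f' := by
  rw [hasWeakDerivFrom_zero_iff, Lp.ext_iff]

lemma primitive_compLp [CompleteSpace E] [CompleteSpace F] (A : E →L[ℝ] F) (f : Lp E 2 vol[b])
    (t : ℝ) : primitive (A.compLpL 2 vol[b] f) t = A (primitive f t) := by
  rw [primitive, primitive, ← ContinuousLinearMap.intervalIntegral_comp_comm _
    (integrable_of_L2 f).intervalIntegrable]
  refine intervalIntegral.integral_congr_ae ?_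
  filter_upwards [A.coeFn_compLpL (p := 2) (μ := vol[b]) f] with x hx _ using hx

lemma prim_compLp [CompleteSpace E] [CompleteSpace F] (A : E →L[ℝ] F) (f : Lp E 2 vol[b]) :
    prim F b (A.compLpL 2 vol[b] f) = A.compLpL 2 vol[b] (prim E b f) := by
  apply Lp.ext
  filter_upwards [coeFn_prim f, coeFn_prim (A.compLpL 2 vol[b] f),
    A.coeFn_compLpL (p := 2) (μ := vol[b]) (prim E b f)] with t h1 h2 h3
  rw [h2, h3, h1, primitive_compLp]

lemma compLpL_comp {G : Type*} [NormedAddCommGroup G] [NormedSpace ℝ G] (A : E →L[ℝ] F)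
    (B : F →L[ℝ] G) (f : Lp E 2 vol[b]) :
    B.compLpL 2 vol[b] (A.compLpL 2 vol[b] f) = (B ∘L A).compLpL 2 vol[b] f := by
  apply Lp.ext
  filter_upwards [B.coeFn_compLpL (p := 2) (μ := vol[b]) (A.compLpL 2 vol[b] f),
    A.coeFn_compLpL (p := 2) (μ := vol[b]) f, (B ∘L A).coeFn_compLpL (p := 2) (μ := vol[b]) f]
    with t h1 h2 h3
  rw [h1, h2, h3]; rfl

end Primitive

/-! ### Integration by parts in time and the adjoint of integration. -/

section Inner

variable {X : Type*} [NormedAddCommGroup X] [InnerProductSpace ℝ X] [CompleteSpace X] {b : ℝ}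

lemma inner_compLp_symm (A : X →L[ℝ] X) (hA : ∀ x y, inner ℝ (A x) y = inner ℝ x (A y))
    (f g : Lp X 2 vol[b]) :
    inner ℝ (A.compLpL 2 vol[b] f) g = inner ℝ f (A.compLpL 2 vol[b] g) := by
  rw [L2.inner_def, L2.inner_def]
  refine integral_congr_ae ?_
  filter_upwards [A.coeFn_compLpL (p := 2) (μ := vol[b]) f,
    A.coeFn_compLpL (p := 2) (μ := vol[b]) g] with t h1 h2
  rw [h1, h2, hA]

lemma le_inner_compLp (A : X →L[ℝ] X) (c : ℝ) (hA : ∀ x, c * ‖x‖ ^ 2 ≤ inner ℝ (A x) x)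
    (f : Lp X 2 vol[b]) : c * ‖f‖ ^ 2 ≤ inner ℝ (A.compLpL 2 vol[b] f) f := by
  rw [← real_inner_self_eq_norm_sq, L2.inner_def, L2.inner_def, ← integral_const_mul]
  refine integral_mono_ae ((L2.integrable_inner f f).const_mul c) (L2.integrable_inner _ _) ?_
  filter_upwards [A.coeFn_compLpL (p := 2) (μ := vol[b]) f] with t h1
  rw [h1, real_inner_self_eq_norm_sq]
  exact hA _

/-- Integration by parts: `⟨∫₀ᵗ y, x⟩ + ⟨y, ∫₀ᵗ x⟩ = ⟨∫₀ᵇ y, ∫₀ᵇ x⟩`. -/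
lemma inner_prim_add (y x : Lp X 2 vol[b]) :
    inner ℝ (prim X b y) x + inner ℝ y (prim X b x)
      = inner ℝ (∫ t, y t ∂vol[b]) (∫ t, x t ∂vol[b]) := by
  have hy := integrable_of_L2 y
  have hx := integrable_of_L2 x
  have hprod : Integrable (fun p : ℝ × ℝ => inner ℝ (y p.2) (x p.1)) (vol[b].prod vol[b]) := by
    refine (hx.norm.mul_prod hy.norm).mono' ?_ (ae_of_all _ fun p => ?_)
    · exact (hy.1.comp_snd).inner (hx.1.comp_fst)
    · rw [mul_comm]; exact norm_inner_le_norm _ _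
  -- Fubini on the square: with `p = (t, s)`, the first term is the integral of `⟨y s, x t⟩` over
  -- the triangle `s ≤ t`, the second the integral over its complement.
  have hle : MeasurableSet {p : ℝ × ℝ | p.2 ≤ p.1} := measurableSet_le measurable_snd measurable_fst
  have hpos : ∀ᵐ t ∂vol[b], 0 < t := by
    filter_upwards [ae_restrict_mem measurableSet_Ioo] with t ht using ht.1
  have h1 : inner ℝ (prim X b y) x =
      ∫ p in {p : ℝ × ℝ | p.2 ≤ p.1}, inner ℝ (y p.2) (x p.1) ∂(vol[b].prod vol[b]) := by
    rw [← integral_indicator hle, integral_prod _ (hprod.indicator hle), L2.inner_def]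
    refine integral_congr_ae ?_
    filter_upwards [coeFn_prim y, hpos] with t h1 h2
    rw [h1, primitive, intervalIntegral.integral_of_le h2.le, real_inner_comm,
      ← integral_inner hy.integrableOn, ← integral_indicator measurableSet_Ioc]
    refine integral_congr_ae ?_
    filter_upwards [hpos] with s hs
    simp only [indicator, mem_Ioc, mem_ofPred_eq, hs, true_and]
    split_ifs <;> simp [real_inner_comm]
  have h2 : inner ℝ y (prim X b x) =
      ∫ p in {p : ℝ × ℝ | p.2 ≤ p.1}ᶜ, inner ℝ (y p.2) (x p.1) ∂(vol[b].prod vol[b]) := by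
    rw [← integral_indicator hle.compl, integral_prod_symm _ (hprod.indicator hle.compl),
      L2.inner_def]
    refine integral_congr_ae ?_
    filter_upwards [coeFn_prim x, hpos] with t h1 h2
    rw [h1, primitive, intervalIntegral.integral_of_le h2.le, integral_Ioc_eq_integral_Ioo,
      ← integral_inner hx.integrableOn, ← integral_indicator measurableSet_Ioo]
    refine integral_congr_ae ?_
    filter_upwards [hpos] with s hs
    simp only [indicator, mem_Ioo, mem_compl_iff, mem_ofPred_eq, hs, true_and, not_le]
  rw [h1, h2, integral_add_compl hle hprod, integral_prod _ hprod]
  have h3 : ∀ t, ∫ s, inner ℝ (y s) (x t) ∂vol[b] = inner ℝ (∫ s, y s ∂vol[b]) (x t) := by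
    intro t
    simp_rw [real_inner_comm (x t)]
    exact integral_inner hy _
  simp only [h3]
  exact integral_inner hx _

/-- A symmetric positive operator `A` satisfies `∫ ⟨A y, ∫₀ᵗ y⟩ ≥ 0`. -/
lemma inner_compLp_prim_nonneg (A : X →L[ℝ] X) (hA : ∀ x y, inner ℝ (A x) y = inner ℝ x (A y))
    (hpos : ∀ x, 0 ≤ inner ℝ (A x) x) (y : Lp X 2 vol[b]) :
    0 ≤ inner ℝ (A.compLpL 2 vol[b] y) (prim X b y) := by
  -- `A` commutes with integration and is symmetric, so the two terms of the integration by parts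
  -- coincide: twice the integral equals `⟨A Y, Y⟩` with `Y = ∫ y`.
  have h := inner_prim_add (A.compLpL 2 vol[b] y) y
  rw [prim_compLp, inner_compLp_symm A hA, real_inner_comm] at h
  have hi : ∫ t, (A.compLpL 2 vol[b] y) t ∂vol[b] = A (∫ t, y t ∂vol[b]) := by
    rw [← A.integral_comp_comm (integrable_of_L2 y)]
    exact integral_congr_ae (A.coeFn_compLpL (p := 2) (μ := vol[b]) y)
  rw [hi] at h
  have := hpos (∫ t, y t ∂vol[b])
  linarith

/-- A primitive vanishing a.e. vanishes on all of `(0,b)` by continuity, and by Lebesgue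
differentiation its derivative is `f` a.e. -/
lemma prim_injective {f : Lp X 2 vol[b]} (hf : prim X b f = 0) : f = 0 := by
  have h0 : EqOn (primitive f) (fun _ => 0) (Ioo 0 b) := by
    refine Measure.eqOn_open_of_ae_eq (μ := volume) ?_ isOpen_Ioo
      (continuous_primitive f).continuousOn continuousOn_const
    refine (coeFn_prim f).symm.trans ?_
    rw [hf]
    exact Lp.coeFn_zero _ _ _
  rw [Lp.eq_zero_iff_ae_eq_zero]
  rcases le_or_gt b 0 with hb | hb
  · filter_upwards [ae_restrict_mem measurableSet_Ioo] with x hx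
    exact absurd (hx.1.trans hx.2) (not_lt.2 hb)
  have hint : IntervalIntegrable f volume 0 b := by
    rw [intervalIntegrable_iff_integrableOn_Ioo_of_le hb.le]
    exact integrable_of_L2 f
  have hd := hint.ae_hasDerivAt_integral
  filter_upwards [ae_restrict_of_ae hd, ae_restrict_mem measurableSet_Ioo] with x hx hxm
  have h1 := hx (by rw [uIcc_of_le hb.le]; exact Ioo_subset_Icc_self hxm) 0 left_mem_uIcc
  refine h1.unique ((hasDerivAt_const x (0 : X)).congr_of_eventuallyEq ?_)
  filter_upwards [Ioo_mem_nhds hxm.1 hxm.2] with y hy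
  rw [← primitive_eq f (Ioo_subset_Icc_self hy), h0 hy]

variable (X b) in
/-- The operator `f ↦ ∫ₜᵇ f`, adjoint to `prim`. -/
abbrev primAdj : Lp X 2 vol[b] →L[ℝ] Lp X 2 vol[b] := (prim X b).adjoint

/-- This is `inner_prim_add` read as an operator identity; it identifies the abstract adjoint with
the tail integral. -/
lemma primAdj_add_prim (f : Lp X 2 vol[b]) :
    primAdj X b f + prim X b f = (memLp_const (∫ t, f t ∂vol[b])).toLp := by
  refine ext_inner_left ℝ fun y => ?_
  rw [inner_add_right, ContinuousLinearMap.adjoint_inner_right, inner_prim_add, L2.inner_def,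
    real_inner_comm, ← integral_inner (integrable_of_L2 y)]
  refine integral_congr_ae ?_
  filter_upwards [(memLp_const (∫ t, f t ∂vol[b])).coeFn_toLp (μ := vol[b]) (p := 2)] with t ht
  rw [ht, real_inner_comm]

lemma coeFn_primAdj (f : Lp X 2 vol[b]) :
    primAdj X b f =ᵐ[vol[b]] fun t => (∫ t, f t ∂vol[b]) - primitive f t := by
  rw [eq_sub_of_add_eq (primAdj_add_prim f)]
  filter_upwards [(memLp_const (∫ t, f t ∂vol[b])).coeFn_toLp (μ := vol[b]) (p := 2),
    coeFn_prim f, Lp.coeFn_sub ((memLp_const (∫ t, f t ∂vol[b])).toLp) (prim X b f)] with t h1 h2 h3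
  rw [h3, Pi.sub_apply, h1, h2]

lemma integral_compLpL {Y : Type*} [NormedAddCommGroup Y] [InnerProductSpace ℝ Y] [CompleteSpace Y]
    (A : X →L[ℝ] Y) (f : Lp X 2 vol[b]) :
    ∫ t, (A.compLpL 2 vol[b] f) t ∂vol[b] = A (∫ t, f t ∂vol[b]) := by
  rw [← A.integral_comp_comm (integrable_of_L2 f)]
  exact integral_congr_ae (A.coeFn_compLpL (p := 2) (μ := vol[b]) f)

lemma primAdj_compLp (A : X →L[ℝ] X) (f : Lp X 2 vol[b]) :
    primAdj X b (A.compLpL 2 vol[b] f) = A.compLpL 2 vol[b] (primAdj X b f) := by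
  apply Lp.ext
  filter_upwards [coeFn_primAdj f, coeFn_primAdj (A.compLpL 2 vol[b] f),
    A.coeFn_compLpL (p := 2) (μ := vol[b]) (primAdj X b f)] with t h1 h2 h3
  rw [h2, h3, h1, primitive_compLp, integral_compLpL, map_sub]

end Inner

/-! ### Range inclusion from an adjoint estimate. -/

section Factorisation

variable {H : Type*} [NormedAddCommGroup H] [InnerProductSpace ℝ H] [CompleteSpace H]

/-- Douglas factorisation: if `‖K* χ‖ ≤ C ‖A* χ‖` and `A` is injective, then `K = A D` with `D`
bounded. -/
lemma exists_comp_eq_of_adjoint_bound (A K : H →L[ℝ] H) (C : ℝ) (hinj : ∀ x, A x = 0 → x = 0)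
    (hb : ∀ χ, ‖K.adjoint χ‖ ≤ C * ‖A.adjoint χ‖) : ∃ D : H →L[ℝ] H, ∀ h, A (D h) = K h := by
  have hd : DenseRange A.adjoint := by
    have h1 : (LinearMap.range A.adjoint.toLinearMap)ᗮ = ⊥ := by
      rw [eq_bot_iff]
      intro x hx
      refine hinj x ?_
      refine ext_inner_left ℝ fun y => ?_
      rw [inner_zero_right, ← ContinuousLinearMap.adjoint_inner_left]
      exact hx _ (LinearMap.mem_range_self _ y)
    have h2 := (Submodule.topologicalClosure_eq_top_iff).2 h1
    intro x
    have : x ∈ (LinearMap.range A.adjoint.toLinearMap).topologicalClosure := by rw [h2]; trivial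
    exact this
  -- The range of `A*` is dense because its orthogonal complement is the kernel of `A`. The bound
  -- therefore extends `A* χ ↦ K* χ` to a bounded operator `G`, and `D = G*`.
  set G := K.adjoint.toLinearMap.extendOfNorm A.adjoint.toLinearMap with hG
  have hGe : ∀ χ, G (A.adjoint χ) = K.adjoint χ := fun χ =>
    LinearMap.extendOfNorm_eq hd ⟨C, hb⟩ χ
  refine ⟨G.adjoint, fun h => ext_inner_left ℝ fun χ => ?_⟩
  rw [← ContinuousLinearMap.adjoint_inner_left, ContinuousLinearMap.adjoint_inner_right, hGe,
    ContinuousLinearMap.adjoint_inner_left]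

end Factorisation

/-! ### The abstract second-order evolution equation. -/

section Evolution

variable {X : Type*} [NormedAddCommGroup X] [InnerProductSpace ℝ X] [CompleteSpace X] {b : ℝ}

/-- The operator `P ∂ₜ + Q + R ∂ₜ⁻¹`, composed with integration in time. -/
def evolOp (b : ℝ) (P Q R : X →L[ℝ] X) : Lp X 2 vol[b] →L[ℝ] Lp X 2 vol[b] :=
  P.compLpL 2 vol[b] + Q.compLpL 2 vol[b] ∘L prim X b +
    R.compLpL 2 vol[b] ∘L prim X b ∘L prim X b

variable {P Q R : X →L[ℝ] X} {c : ℝ}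

/-- Energy estimate: with `y = ∂ₜ⁻¹ζ` as test function, the `P` and `R` terms integrate to
nonnegative quadratic forms at the final time, which leaves only the damping term. -/
lemma evolOp_coercive
    (hP : ∀ x y, inner ℝ (P x) y = inner ℝ x (P y)) (hP0 : ∀ x, 0 ≤ inner ℝ (P x) x)
    (hQ : ∀ x, c * ‖x‖ ^ 2 ≤ inner ℝ (Q x) x)
    (hR : ∀ x y, inner ℝ (R x) y = inner ℝ x (R y)) (hR0 : ∀ x, 0 ≤ inner ℝ (R x) x)
    (ζ : Lp X 2 vol[b]) :
    c * ‖prim X b ζ‖ ^ 2 ≤ inner ℝ (evolOp b P Q R ζ) (prim X b ζ) := by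
  have h1 := inner_compLp_prim_nonneg P hP hP0 ζ
  have h2 := le_inner_compLp Q c hQ (prim X b ζ)
  have h3 := inner_compLp_prim_nonneg R hR hR0 (prim X b ζ)
  rw [inner_compLp_symm R hR, real_inner_comm] at h3
  simp only [evolOp, add_apply, ContinuousLinearMap.comp_apply, inner_add_left]
  linarith

lemma evolOp_injective (hc : 0 < c)
    (hP : ∀ x y, inner ℝ (P x) y = inner ℝ x (P y)) (hP0 : ∀ x, 0 ≤ inner ℝ (P x) x)
    (hQ : ∀ x, c * ‖x‖ ^ 2 ≤ inner ℝ (Q x) x)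
    (hR : ∀ x y, inner ℝ (R x) y = inner ℝ x (R y)) (hR0 : ∀ x, 0 ≤ inner ℝ (R x) x)
    (ζ : Lp X 2 vol[b]) (h : evolOp b P Q R ζ = 0) : ζ = 0 := by
  have := evolOp_coercive hP hP0 hQ hR hR0 ζ
  rw [h, inner_zero_left] at this
  have h2 : ‖prim X b ζ‖ ^ 2 ≤ 0 := by
    by_contra! h0
    nlinarith
  exact prim_injective (norm_eq_zero.1 (pow_eq_zero_iff two_ne_zero |>.1
    (le_antisymm h2 (by positivity))))

lemma adjoint_compLpL (A : X →L[ℝ] X) (hA : ∀ x y, inner ℝ (A x) y = inner ℝ x (A y)) :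
    (A.compLpL 2 vol[b]).adjoint = A.compLpL 2 vol[b] := by
  symm
  rw [ContinuousLinearMap.eq_adjoint_iff]
  exact inner_compLp_symm A hA

/-- The same energy estimate run backwards in time: the adjoint equation is tested with `θ = ∫ₜᵇ χ`,
and one factor `‖θ‖` is cancelled. The bound controls only this primitive of `χ`, which is why the
load has to be of the form `∂ₜ⁻¹h`. -/
lemma evolOp_adjoint_bound (hc : 0 < c)
    (hP : ∀ x y, inner ℝ (P x) y = inner ℝ x (P y)) (hP0 : ∀ x, 0 ≤ inner ℝ (P x) x)
    (hQs : ∀ x y, inner ℝ (Q x) y = inner ℝ x (Q y))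
    (hQ : ∀ x, c * ‖x‖ ^ 2 ≤ inner ℝ (Q x) x)
    (hR : ∀ x y, inner ℝ (R x) y = inner ℝ x (R y)) (hR0 : ∀ x, 0 ≤ inner ℝ (R x) x)
    (χ : Lp X 2 vol[b]) :
    ‖primAdj X b χ‖ ≤ c⁻¹ * ‖(evolOp b P Q R).adjoint χ‖ := by
  set θ := primAdj X b χ with hθ
  have he : (evolOp b P Q R).adjoint χ = P.compLpL 2 vol[b] χ + Q.compLpL 2 vol[b] θ
      + R.compLpL 2 vol[b] (primAdj X b θ) := by
    simp only [evolOp, map_add, ContinuousLinearMap.adjoint_comp, adjoint_compLpL P hP,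
      adjoint_compLpL Q hQs, adjoint_compLpL R hR, add_apply,
      ContinuousLinearMap.comp_apply, primAdj_compLp, hθ]
  have h1 := inner_compLp_prim_nonneg P hP hP0 χ
  rw [← ContinuousLinearMap.adjoint_inner_left, primAdj_compLp, inner_compLp_symm P hP,
    real_inner_comm] at h1
  have h2 := le_inner_compLp Q c hQ θ
  have h3 := inner_compLp_prim_nonneg R hR hR0 θ
  rw [← ContinuousLinearMap.adjoint_inner_left, primAdj_compLp] at h3
  have h4 : c * ‖θ‖ ^ 2 ≤ inner ℝ ((evolOp b P Q R).adjoint χ) θ := by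
    rw [he]
    simp only [inner_add_left]
    linarith
  have h5 := h4.trans (real_inner_le_norm _ _)
  rcases eq_or_lt_of_le (norm_nonneg θ) with h0 | h0
  · rw [← h0]; positivity
  · rw [le_inv_mul_iff₀ hc]
    refine le_of_mul_le_mul_right ?_ h0
    nlinarith

/-- Solvability of `P ζ + Q ∫₀ᵗ ζ + R ∫₀ᵗ∫₀ˢ ζ = ∫₀ᵗ h`, with `ζ` depending continuously on `h`. -/
lemma exists_evolOp_solution (hc : 0 < c)
    (hP : ∀ x y, inner ℝ (P x) y = inner ℝ x (P y)) (hP0 : ∀ x, 0 ≤ inner ℝ (P x) x)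
    (hQs : ∀ x y, inner ℝ (Q x) y = inner ℝ x (Q y))
    (hQ : ∀ x, c * ‖x‖ ^ 2 ≤ inner ℝ (Q x) x)
    (hR : ∀ x y, inner ℝ (R x) y = inner ℝ x (R y)) (hR0 : ∀ x, 0 ≤ inner ℝ (R x) x) :
    ∃ D : Lp X 2 vol[b] →L[ℝ] Lp X 2 vol[b], ∀ h, evolOp b P Q R (D h) = prim X b h :=
  exists_comp_eq_of_adjoint_bound _ _ c⁻¹ (evolOp_injective hc hP hP0 hQ hR hR0)
    (evolOp_adjoint_bound hc hP hP0 hQs hQ hR hR0)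

end Evolution

/-! ### Least squares on bounded closed convex sets. -/

section Minimisation

variable {H K : Type*} [NormedAddCommGroup H] [InnerProductSpace ℝ H] [CompleteSpace H]
  [NormedAddCommGroup K] [InnerProductSpace ℝ K]

/-- A nonincreasing sequence of nonempty, closed, convex subsets of a bounded set in a Hilbert space
has a common point. -/
lemma nonempty_iInter_of_convex (W : ℕ → Set H) (hne : ∀ n, (W n).Nonempty)
    (hcl : ∀ n, IsClosed (W n)) (hcv : ∀ n, Convex ℝ (W n)) (hanti : Antitone W) (B : ℝ)
    (hB : ∀ x ∈ W 0, ‖x‖ ≤ B) : (⋂ n, W n).Nonempty := by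
  have hmin : ∀ n, ∃ x ∈ W n, ∀ y ∈ W n, ‖x‖ ≤ ‖y‖ := by
    intro n
    obtain ⟨x, hx, h⟩ := exists_norm_eq_iInf_of_complete_convex (hne n) (hcl n).isComplete (hcv n) 0
    refine ⟨x, hx, fun y hy => ?_⟩
    have h1 : ⨅ w : W n, ‖(0 : H) - w‖ ≤ ‖(0 : H) - y‖ :=
      ciInf_le ⟨0, by rintro _ ⟨w, rfl⟩; exact norm_nonneg _⟩ (⟨y, hy⟩ : W n)
    rw [← h] at h1
    simpa using h1
  choose p hp hpm using hmin
  have hmono : Monotone fun n => ‖p n‖ := fun m n hmn => hpm m _ (hanti hmn (hp n))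
  have hbdd : BddAbove (range fun n => ‖p n‖) :=
    ⟨B, by rintro _ ⟨n, rfl⟩; exact hB _ (hanti (Nat.zero_le n) (hp n))⟩
  have hlim := tendsto_atTop_ciSup hmono hbdd
  set s := ⨆ n, ‖p n‖
  have hps : ∀ n, ‖p n‖ ≤ s := fun n => le_ciSup hbdd n
  -- The `p n` are the elements of least norm. The midpoint of `p n` and `p m` lies in `W N`, so its
  -- norm is at least `‖p N‖`; the parallelogram law gives `‖p n - p m‖² ≤ 4 (s² - ‖p N‖²)`.
  have hcauchy : CauchySeq p := by
    refine cauchySeq_of_le_tendsto_0 (fun n => Real.sqrt (4 * (s ^ 2 - ‖p n‖ ^ 2))) ?_ ?_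
    · intro n m N hn hm
      rw [dist_eq_norm]
      refine Real.le_sqrt_of_sq_le ?_
      have hmid : ‖p N‖ ≤ ‖(1 / 2 : ℝ) • p n + (1 / 2 : ℝ) • p m‖ :=
        hpm N _ ((hcv N) (hanti hn (hp n)) (hanti hm (hp m)) (by norm_num) (by norm_num)
          (by norm_num))
      rw [← smul_add, norm_smul, Real.norm_of_nonneg (by norm_num)] at hmid
      have hpar := parallelogram_law_with_norm ℝ (p n) (p m)
      have h1 := hps n
      have h2 := hps m
      have h3 := norm_nonneg (p N)
      have h4 : ‖p n‖ * ‖p n‖ ≤ s * s := mul_self_le_mul_self (norm_nonneg _) h1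
      have h5 : ‖p m‖ * ‖p m‖ ≤ s * s := mul_self_le_mul_self (norm_nonneg _) h2
      have h6 : ‖p N‖ * ‖p N‖ ≤ _ := mul_self_le_mul_self (norm_nonneg _) hmid
      nlinarith
    · have : Filter.Tendsto (fun n => Real.sqrt (4 * (s ^ 2 - ‖p n‖ ^ 2))) Filter.atTop
          (nhds (Real.sqrt (4 * (s ^ 2 - s ^ 2)))) :=
        (Real.continuous_sqrt.tendsto _).comp
          ((tendsto_const_nhds.sub (hlim.pow 2)).const_mul 4)
      simpa using this
  obtain ⟨q, hq⟩ := cauchySeq_tendsto_of_complete hcauchy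
  refine ⟨q, mem_iInter.2 fun n => ?_⟩
  exact (hcl n).mem_of_tendsto hq (Filter.eventually_atTop.2 ⟨n, fun m hm => hanti hm (hp m)⟩)

/-- A bounded linear least squares problem on a bounded closed convex set has a minimiser. -/
lemma exists_isMinOn_norm_sub (W : Set H) (hne : W.Nonempty) (hcl : IsClosed W)
    (hcv : Convex ℝ W) (B : ℝ) (hB : ∀ x ∈ W, ‖x‖ ≤ B) (A : H →L[ℝ] K) (k : K) :
    ∃ x ∈ W, IsMinOn (fun y => ‖A y - k‖) W x := by
  set m := sInf ((fun y => ‖A y - k‖) '' W) with hm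
  have hbd : BddBelow ((fun y => ‖A y - k‖) '' W) :=
    ⟨0, by rintro _ ⟨w, _, rfl⟩; exact norm_nonneg _⟩
  have hcont : Continuous fun y => ‖A y - k‖ := (A.continuous.sub continuous_const).norm
  have hconv : ConvexOn ℝ univ fun y => ‖A y - k‖ := by
    have h1 := (convexOn_norm (E := K) convex_univ).translate_left (-k)
    have h2 := h1.comp_linearMap A.toLinearMap
    simpa [Function.comp_def, sub_eq_add_neg] using h2
  -- The nested sets are the sublevel sets at `m + 1/(n+1)`; a common point attains the infimum `m`.
  obtain ⟨x, hx⟩ := nonempty_iInter_of_convex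
    (fun n : ℕ => W ∩ {y | ‖A y - k‖ ≤ m + 1 / ((n : ℝ) + 1)})
    (fun n => by
      obtain ⟨_, ⟨y, hy, rfl⟩, hlt⟩ := exists_lt_of_csInf_lt (hne.image _)
        (show m < m + 1 / ((n : ℝ) + 1) by linarith [Nat.one_div_pos_of_nat (α := ℝ) (n := n)])
      exact ⟨y, hy, hlt.le⟩)
    (fun n => hcl.inter (isClosed_le hcont continuous_const))
    (fun n => by
      have := hconv.convex_le (m + 1 / ((n : ℝ) + 1))
      simpa using hcv.inter this)
    (fun i j hij y hy => ⟨hy.1, mem_ofPred.2 <| (mem_ofPred.1 hy.2).trans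
      (add_le_add le_rfl (Nat.one_div_le_one_div hij))⟩) B (fun y hy => hB y hy.1)
  rw [mem_iInter] at hx
  refine ⟨x, (hx 0).1, fun y hy => ?_⟩
  have hlim : Filter.Tendsto (fun n : ℕ => m + 1 / ((n : ℝ) + 1)) Filter.atTop (nhds (m + 0)) :=
    tendsto_const_nhds.add tendsto_one_div_add_atTop_nhds_zero_nat
  have h1 : ‖A x - k‖ ≤ m + 0 := ge_of_tendsto' hlim fun n => (hx n).2
  exact h1.trans ((add_zero m).le.trans (csInf_le hbd ⟨y, hy, rfl⟩))

end Minimisation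

/-! ### Multiplication operators on `L²(0,b)`. -/

section Multiplication

variable {b : ℝ}

/-- Multiplication by a bounded function, as an operator on `L²(0,b)`. -/
def mulOp (m : Lp ℝ ∞ vol[b]) : L2 b →L[ℝ] L2 b :=
  (ContinuousLinearMap.mul ℝ ℝ).holderL vol[b] ∞ 2 2 m

lemma coeFn_mulOp (m : Lp ℝ ∞ vol[b]) (f : L2 b) :
    mulOp m f =ᵐ[vol[b]] fun x => m x * f x :=
  (ContinuousLinearMap.mul ℝ ℝ).coeFn_holder m f

lemma inner_mulOp (m : Lp ℝ ∞ vol[b]) (f g : L2 b) :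
    inner ℝ (mulOp m f) g = ∫ x in Ioo 0 b, m x * f x * g x := by
  rw [L2.inner_def]
  refine integral_congr_ae ?_
  filter_upwards [coeFn_mulOp m f] with x hx
  rw [hx, RCLike.inner_apply, conj_trivial, mul_comm]

lemma inner_mulOp_symm (m : Lp ℝ ∞ vol[b]) (f g : L2 b) :
    inner ℝ (mulOp m f) g = inner ℝ f (mulOp m g) := by
  rw [real_inner_comm (mulOp m g), inner_mulOp, inner_mulOp]
  congr 1
  ext x
  ring

lemma le_inner_mulOp (m : Lp ℝ ∞ vol[b]) {c : ℝ} (hc : ∀ᵐ x ∂vol[b], c ≤ m x) (f : L2 b) :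
    c * ‖f‖ ^ 2 ≤ inner ℝ (mulOp m f) f := by
  rw [← real_inner_self_eq_norm_sq, L2.inner_def, L2.inner_def, ← integral_const_mul]
  refine integral_mono_ae ((L2.integrable_inner f f).const_mul c) (L2.integrable_inner _ _) ?_
  filter_upwards [hc, coeFn_mulOp m f] with x hx h1
  rw [h1, real_inner_self_eq_norm_sq]
  simp only [Real.norm_eq_abs, sq_abs, RCLike.inner_apply, conj_trivial]
  nlinarith [sq_nonneg (f x)]

end Multiplication

/-! ### Identification of `V` with `L²(0,ℓ)` through the second derivative. -/

section StateSpace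

variable {ℓ : ℝ}

lemma mem_V_iff (p : PiLp 2 fun _ : Fin 3 => L2 ℓ) :
    p ∈ V ℓ ↔ p 0 = prim ℝ ℓ (p 1) ∧ p 1 = prim ℝ ℓ (p 2) := by
  rw [← hasWeakDerivFrom_Lp_iff, ← hasWeakDerivFrom_Lp_iff]
  rfl

variable (ℓ) in
/-- `fn` as a continuous linear map. -/
def fnL : V ℓ →L[ℝ] L2 ℓ := PiLp.proj 2 (fun _ : Fin 3 => L2 ℓ) 0 ∘L (V ℓ).subtypeL

variable (ℓ) in
/-- `dxx` as a continuous linear map. -/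
def dxxL : V ℓ →L[ℝ] L2 ℓ := PiLp.proj 2 (fun _ : Fin 3 => L2 ℓ) 2 ∘L (V ℓ).subtypeL

lemma dxxL_apply (v : V ℓ) : dxxL ℓ v = dxx v := rfl

variable (ℓ) in
/-- The function in `V` with a given second derivative. -/
def lift : L2 ℓ →L[ℝ] V ℓ :=
  ((PiLp.continuousLinearEquiv 2 ℝ (fun _ : Fin 3 => L2 ℓ)).symm.toContinuousLinearMap ∘L
    ContinuousLinearMap.pi
      ![prim ℝ ℓ ∘L prim ℝ ℓ, prim ℝ ℓ, ContinuousLinearMap.id ℝ (L2 ℓ)]).codRestrict (V ℓ)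
    (fun η => by rw [mem_V_iff]; exact ⟨rfl, rfl⟩)

variable (ℓ) in
/-- Twofold integration, which recovers `v` from `v_xx`. -/
def int2 : L2 ℓ →L[ℝ] L2 ℓ := prim ℝ ℓ ∘L prim ℝ ℓ

lemma fn_eq (v : V ℓ) : fn v = int2 ℓ (dxx v) := by
  obtain ⟨h1, h2⟩ := (mem_V_iff (v : PiLp 2 fun _ : Fin 3 => L2 ℓ)).1 v.2
  rw [fn, h1, h2]; rfl

lemma lift_dxx (v : V ℓ) : lift ℓ (dxx v) = v := by
  obtain ⟨h1, h2⟩ := (mem_V_iff (v : PiLp 2 fun _ : Fin 3 => L2 ℓ)).1 v.2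
  apply Subtype.ext
  apply PiLp.ext
  intro i
  fin_cases i
  · change prim ℝ ℓ (prim ℝ ℓ _) = _
    rw [dxx, ← h2, ← h1]; rfl
  · change prim ℝ ℓ _ = _
    rw [dxx, ← h2]; rfl
  · rfl

/-- Continuous representatives that agree a.e. on a nondegenerate interval agree up to its
endpoints, so the choice inside `trace` is immaterial. -/
lemma trace_eq (hℓ : 0 < ℓ) {f F : ℝ → ℝ} (hF : IsContRep ℓ f F) {x : ℝ} (hx : x ∈ Icc 0 ℓ) :
    trace ℓ f x = F x := by
  have h : ∃ F, IsContRep ℓ f F := ⟨F, hF⟩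
  rw [trace, dif_pos h]
  have h1 := h.choose_spec
  have h2 : h.choose =ᵐ[volume.restrict (Icc 0 ℓ)] F := by
    rw [← restrict_Ioo_eq_restrict_Icc]
    exact h1.2.symm.trans hF.2
  exact Measure.eqOn_Icc_of_ae_eq volume hℓ.ne h2 h1.1 hF.1 hx

lemma isContRep_prim (f : L2 ℓ) : IsContRep ℓ (prim ℝ ℓ f) (primitive f) :=
  ⟨(continuous_primitive f).continuousOn, coeFn_prim f⟩

lemma isContRep_fn (v : V ℓ) : IsContRep ℓ (fn v) (primitive (prim ℝ ℓ (dxx v))) := by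
  rw [fn_eq]; exact isContRep_prim _

variable (ℓ) in
/-- The constant function `1`. -/
def oneL2 : L2 ℓ := (memLp_const (1 : ℝ)).toLp

lemma inner_oneL2 (f : L2 ℓ) : inner ℝ (oneL2 ℓ) f = ∫ x, f x ∂vol[ℓ] := by
  rw [L2.inner_def]
  refine integral_congr_ae ?_
  filter_upwards [(memLp_const (1 : ℝ)).coeFn_toLp (μ := vol[ℓ]) (p := 2)] with x hx
  simp only [oneL2, hx, RCLike.inner_apply, conj_trivial, mul_one]

lemma primitive_end (hℓ : 0 < ℓ) {E : Type*} [NormedAddCommGroup E] [NormedSpace ℝ E]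
    (f : Lp E 2 vol[ℓ]) : primitive f ℓ = ∫ x, f x ∂vol[ℓ] := by
  rw [primitive_eq f ⟨hℓ.le, le_rfl⟩, intervalIntegral.integral_of_le hℓ.le,
    integral_Ioc_eq_integral_Ioo]

variable (ℓ) in
/-- The function `x ↦ ℓ - x`, which represents `v ↦ v(ℓ)` in terms of `v_xx`. -/
def tipL2 : L2 ℓ := primAdj ℝ ℓ (oneL2 ℓ)

/-- `v(ℓ)` is the integral of `v_x = ∫₀ˣ v_xx`; moving the integration onto the constant `1` gives
its Riesz representative in terms of `v_xx`. -/
lemma trace_fn (hℓ : 0 < ℓ) (v : V ℓ) : trace ℓ (fn v) ℓ = inner ℝ (tipL2 ℓ) (dxx v) := by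
  rw [trace_eq hℓ (isContRep_fn v) ⟨hℓ.le, le_rfl⟩, primitive_end hℓ, ← inner_oneL2, tipL2,
    ContinuousLinearMap.adjoint_inner_left]

end StateSpace

lemma inner_compLp_adjoint {X : Type*} [NormedAddCommGroup X] [InnerProductSpace ℝ X]
    [CompleteSpace X] {b : ℝ} (A : X →L[ℝ] X) (f g : Lp X 2 vol[b]) :
    inner ℝ (A.adjoint.compLpL 2 vol[b] f) g = inner ℝ f (A.compLpL 2 vol[b] g) := by
  rw [L2.inner_def, L2.inner_def]
  refine integral_congr_ae ?_
  filter_upwards [A.adjoint.coeFn_compLpL (p := 2) (μ := vol[b]) f,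
    A.coeFn_compLpL (p := 2) (μ := vol[b]) g] with t h1 h2
  rw [h1, h2, ContinuousLinearMap.adjoint_inner_left]

/-! ### The weak formulation as an operator equation. -/

section WeakForm

variable {ℓ T : ℝ}

/-- The left hand side of the weak equation, as an element of `L²(0,T;L²(0,ℓ))` paired with
second derivatives of test functions. -/
def beamOp (mρ mμ mr mκ : Lp ℝ ∞ vol[ℓ]) (s : Evolution ℓ T) : Lp (L2 ℓ) 2 vol[T] :=
  ((int2 ℓ).adjoint ∘L mulOp mρ).compLpL 2 vol[T] s.2.2 +
    ((int2 ℓ).adjoint ∘L mulOp mμ ∘L fnL ℓ).compLpL 2 vol[T] s.2.1 +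
    (mulOp mr ∘L dxxL ℓ).compLpL 2 vol[T] s.1 +
    (mulOp mκ ∘L dxxL ℓ).compLpL 2 vol[T] s.2.1

/-- The boundary load, as an element of `L²(0,T;L²(0,ℓ))`. -/
def tipLoad (g : L2 T) : Lp (L2 ℓ) 2 vol[T] :=
  (ContinuousLinearMap.toSpanSingleton ℝ (tipL2 ℓ)).compLpL 2 vol[T] g

lemma integral_mul_eq_inner {ρ : ℝ → ℝ} {mρ : Lp ℝ ∞ vol[ℓ]} (hρ : ρ =ᵐ[vol[ℓ]] mρ) (f g : L2 ℓ) :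
    ∫ x in Ioo 0 ℓ, ρ x * f x * g x = inner ℝ (mulOp mρ f) g := by
  rw [inner_mulOp]
  refine integral_congr_ae ?_
  filter_upwards [hρ] with x hx
  rw [hx]

/-- The exceptional null set may depend on `x`; separability of `X` makes countably many `x`
sufficient. -/
lemma Lp_eq_of_forall_inner {X : Type*} [NormedAddCommGroup X] [InnerProductSpace ℝ X]
    [SecondCountableTopology X] {b : ℝ} (f g : Lp X 2 vol[b])
    (h : ∀ x : X, ∀ᵐ t ∂vol[b], inner ℝ (f t) x = inner ℝ (g t) x) : f = g := by
  rw [← sub_eq_zero, Lp.eq_zero_iff_ae_eq_zero]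
  refine ae_eq_zero_of_forall_inner (𝕜 := ℝ) fun x => ?_
  filter_upwards [h x, Lp.coeFn_sub f g] with t h1 h2
  rw [h2, Pi.sub_apply, inner_sub_right, real_inner_comm, h1, real_inner_comm, sub_self]
  rfl

lemma coeFn_tipLoad (g : L2 T) : tipLoad (ℓ := ℓ) g =ᵐ[vol[T]] fun t => g t • tipL2 ℓ :=
  (ContinuousLinearMap.toSpanSingleton ℝ (tipL2 ℓ)).coeFn_compLpL (p := 2) (μ := vol[T]) g

lemma coeFn_add_four {X : Type*} [NormedAddCommGroup X] {b : ℝ} {A₁ A₂ A₃ A₄ : Lp X 2 vol[b]}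
    {f₁ f₂ f₃ f₄ : ℝ → X} (h₁ : A₁ =ᵐ[vol[b]] f₁) (h₂ : A₂ =ᵐ[vol[b]] f₂)
    (h₃ : A₃ =ᵐ[vol[b]] f₃) (h₄ : A₄ =ᵐ[vol[b]] f₄) :
    (A₁ + A₂ + A₃ + A₄ : Lp X 2 vol[b]) =ᵐ[vol[b]] fun t => f₁ t + f₂ t + f₃ t + f₄ t := by
  filter_upwards [Lp.coeFn_add (A₁ + A₂ + A₃) A₄, Lp.coeFn_add (A₁ + A₂) A₃, Lp.coeFn_add A₁ A₂,
    h₁, h₂, h₃, h₄] with t a1 a2 a3 b1 b2 b3 b4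
  rw [a1, Pi.add_apply, a2, Pi.add_apply, a3, Pi.add_apply, b1, b2, b3, b4]

lemma coeFn_beamOp (mρ mμ mr mκ : Lp ℝ ∞ vol[ℓ]) (s : Evolution ℓ T) :
    beamOp mρ mμ mr mκ s =ᵐ[vol[T]] fun t =>
      (int2 ℓ).adjoint (mulOp mρ (s.2.2 t)) + (int2 ℓ).adjoint (mulOp mμ (fn (s.2.1 t))) +
        mulOp mr (dxx (s.1 t)) + mulOp mκ (dxx (s.2.1 t)) :=
  coeFn_add_four
    (((int2 ℓ).adjoint ∘L mulOp mρ).coeFn_compLpL (p := 2) (μ := vol[T]) s.2.2)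
    (((int2 ℓ).adjoint ∘L mulOp mμ ∘L fnL ℓ).coeFn_compLpL (p := 2) (μ := vol[T]) s.2.1)
    ((mulOp mr ∘L dxxL ℓ).coeFn_compLpL (p := 2) (μ := vol[T]) s.1)
    ((mulOp mκ ∘L dxxL ℓ).coeFn_compLpL (p := 2) (μ := vol[T]) s.2.1)

lemma weak_form_iff_inner (hℓ : 0 < ℓ) {ρ μ r κ : ℝ → ℝ} {mρ mμ mr mκ : Lp ℝ ∞ vol[ℓ]}
    (hρ : ρ =ᵐ[vol[ℓ]] mρ) (hμ : μ =ᵐ[vol[ℓ]] mμ) (hr : r =ᵐ[vol[ℓ]] mr) (hκ : κ =ᵐ[vol[ℓ]] mκ)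
    (g : L2 T) (s : Evolution ℓ T) :
    ∀ᵐ t ∂vol[T], ∀ v : V ℓ,
      ((∫ x in Ioo 0 ℓ, ρ x * s.2.2 t x * fn v x) +
      (∫ x in Ioo 0 ℓ, μ x * fn (s.2.1 t) x * fn v x) +
      (∫ x in Ioo 0 ℓ, r x * dxx (s.1 t) x * dxx v x) +
      (∫ x in Ioo 0 ℓ, κ x * dxx (s.2.1 t) x * dxx v x) = g t * trace ℓ (fn v) ℓ ↔
      inner ℝ (beamOp mρ mμ mr mκ s t) (dxx v) =
        inner ℝ (tipLoad (ℓ := ℓ) g t) (dxx v)) := by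
  filter_upwards [coeFn_beamOp mρ mμ mr mκ s, coeFn_tipLoad (ℓ := ℓ) g] with t h1 h2 v
  rw [h1, h2, integral_mul_eq_inner hρ, integral_mul_eq_inner hμ, integral_mul_eq_inner hr,
    integral_mul_eq_inner hκ, trace_fn hℓ, fn_eq v]
  simp only [inner_add_left, ContinuousLinearMap.adjoint_inner_left, real_inner_smul_left]

instance L2.secondCountableTopology (b : ℝ) : SecondCountableTopology (L2 b) := by
  have : Fact ((2 : ℝ≥0∞) ≠ ∞) := ⟨by norm_num⟩
  exact Lp.SecondCountableTopology

/-- Every `η` in `L²(0,ℓ)` is the second derivative of the test function `lift ℓ η`, so the scalar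
identities determine the vector-valued one. -/
lemma isWeakSolution_iff (hℓ : 0 < ℓ) {ρ μ r κ : ℝ → ℝ} {mρ mμ mr mκ : Lp ℝ ∞ vol[ℓ]}
    (hρ : ρ =ᵐ[vol[ℓ]] mρ) (hμ : μ =ᵐ[vol[ℓ]] mμ) (hr : r =ᵐ[vol[ℓ]] mr) (hκ : κ =ᵐ[vol[ℓ]] mκ)
    (g : L2 T) (s : Evolution ℓ T) :
    IsWeakSolution ℓ T ρ μ r κ g s ↔
      s.1 = prim (V ℓ) T s.2.1 ∧ (fnL ℓ).compLpL 2 vol[T] s.2.1 = prim (L2 ℓ) T s.2.2 ∧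
        beamOp mρ mμ mr mκ s = tipLoad g := by
  have h1 : HasWeakDerivFrom T 0 s.1 s.2.1 ↔ s.1 = prim (V ℓ) T s.2.1 := hasWeakDerivFrom_Lp_iff _ _
  have h2 : HasWeakDerivFrom T 0 (fun t => fn (s.2.1 t)) s.2.2 ↔
      (fnL ℓ).compLpL 2 vol[T] s.2.1 = prim (L2 ℓ) T s.2.2 := by
    rw [hasWeakDerivFrom_zero_iff, Lp.ext_iff]
    have := (fnL ℓ).coeFn_compLpL (p := 2) (μ := vol[T]) s.2.1
    exact ⟨fun h => this.trans h, fun h => this.symm.trans h⟩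
  have h3 := weak_form_iff_inner hℓ hρ hμ hr hκ g s
  constructor
  · intro h
    refine ⟨h1.1 h.deriv_u, h2.1 h.deriv_ut, Lp_eq_of_forall_inner _ _ fun η => ?_⟩
    filter_upwards [h3, h.weak_form (lift ℓ η)] with t ht hv
    exact (ht (lift ℓ η)).1 hv
  · rintro ⟨k1, k2, k3⟩
    refine ⟨h1.2 k1, h2.2 k2, fun v => ?_⟩
    filter_upwards [h3] with t ht
    rw [ht v, k3]

end WeakForm

/-! ### Existence and uniqueness for the beam. -/

section WellPosedness

variable {ℓ T c : ℝ} {mρ mμ mr mκ : Lp ℝ ∞ vol[ℓ]}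

/-- The evolution whose second space derivative of the acceleration is `ζ`. -/
def evolutionOf (ζ : Lp (L2 ℓ) 2 vol[T]) : Evolution ℓ T :=
  ((lift ℓ).compLpL 2 vol[T] (prim (L2 ℓ) T (prim (L2 ℓ) T ζ)),
    (lift ℓ).compLpL 2 vol[T] (prim (L2 ℓ) T ζ), (int2 ℓ).compLpL 2 vol[T] ζ)

/-- The inertia operator, acting on second space derivatives. -/
def inertiaOp (mρ : Lp ℝ ∞ vol[ℓ]) : L2 ℓ →L[ℝ] L2 ℓ :=
  (int2 ℓ).adjoint ∘L mulOp mρ ∘L int2 ℓ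

lemma inertiaOp_symm (x y : L2 ℓ) : inner ℝ (inertiaOp mρ x) y = inner ℝ x (inertiaOp mρ y) := by
  simp only [inertiaOp, ContinuousLinearMap.comp_apply, ContinuousLinearMap.adjoint_inner_left,
    ContinuousLinearMap.adjoint_inner_right, inner_mulOp_symm]

lemma mulOp_nonneg (h : ∀ᵐ x ∂vol[ℓ], 0 ≤ mρ x) (x : L2 ℓ) : 0 ≤ inner ℝ (mulOp mρ x) x := by
  simpa using le_inner_mulOp mρ h x

lemma inertiaOp_nonneg (h : ∀ᵐ x ∂vol[ℓ], 0 ≤ mρ x) (x : L2 ℓ) :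
    0 ≤ inner ℝ (inertiaOp mρ x) x := by
  simp only [inertiaOp, ContinuousLinearMap.comp_apply, ContinuousLinearMap.adjoint_inner_left]
  exact mulOp_nonneg h _

lemma dxxL_comp_lift : dxxL ℓ ∘L lift ℓ = ContinuousLinearMap.id ℝ (L2 ℓ) := rfl

lemma fnL_comp_lift : fnL ℓ ∘L lift ℓ = int2 ℓ := rfl

lemma fnL_eq : fnL ℓ = int2 ℓ ∘L dxxL ℓ := ContinuousLinearMap.ext fn_eq

lemma lift_comp_dxxL : lift ℓ ∘L dxxL ℓ = ContinuousLinearMap.id ℝ (V ℓ) :=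
  ContinuousLinearMap.ext lift_dxx

/-- The terms of `beamOp`, in terms of the second space derivatives. -/
lemma beamOp_eq (u a : Lp (V ℓ) 2 vol[T]) (p : Lp (L2 ℓ) 2 vol[T]) :
    beamOp mρ mμ mr mκ (u, a, p) =
      (int2 ℓ).adjoint.compLpL 2 vol[T] ((mulOp mρ).compLpL 2 vol[T] p) +
      (inertiaOp mμ).compLpL 2 vol[T] ((dxxL ℓ).compLpL 2 vol[T] a) +
      (mulOp mr).compLpL 2 vol[T] ((dxxL ℓ).compLpL 2 vol[T] u) +
      (mulOp mκ).compLpL 2 vol[T] ((dxxL ℓ).compLpL 2 vol[T] a) := by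
  have e2 : (int2 ℓ).adjoint ∘L mulOp mμ ∘L fnL ℓ = inertiaOp mμ ∘L dxxL ℓ := by
    rw [fnL_eq, inertiaOp]; simp only [ContinuousLinearMap.comp_assoc]
  rw [compLpL_comp, compLpL_comp, compLpL_comp, compLpL_comp, ← e2, beamOp]

lemma dxx_lift_compLpL (f : Lp (L2 ℓ) 2 vol[T]) :
    (dxxL ℓ).compLpL 2 vol[T] ((lift ℓ).compLpL 2 vol[T] f) = f := by
  rw [compLpL_comp, dxxL_comp_lift]
  exact Lp.ext ((ContinuousLinearMap.id ℝ (L2 ℓ)).coeFn_compLpL f)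

lemma lift_dxx_compLpL (f : Lp (V ℓ) 2 vol[T]) :
    (lift ℓ).compLpL 2 vol[T] ((dxxL ℓ).compLpL 2 vol[T] f) = f := by
  rw [compLpL_comp, lift_comp_dxxL]
  exact Lp.ext ((ContinuousLinearMap.id ℝ (V ℓ)).coeFn_compLpL f)

lemma beamOp_evolutionOf (ζ : Lp (L2 ℓ) 2 vol[T]) :
    beamOp mρ mμ mr mκ (evolutionOf ζ) =
      evolOp T (inertiaOp mρ) (mulOp mκ + inertiaOp mμ) (mulOp mr) ζ := by
  have e1 : (int2 ℓ).adjoint.compLpL 2 vol[T] ((mulOp mρ).compLpL 2 vol[T]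
      ((int2 ℓ).compLpL 2 vol[T] ζ)) = (inertiaOp mρ).compLpL 2 vol[T] ζ := by
    rw [compLpL_comp, compLpL_comp, inertiaOp, ContinuousLinearMap.comp_assoc]
  rw [evolutionOf, beamOp_eq, dxx_lift_compLpL, dxx_lift_compLpL, e1, evolOp,
    ContinuousLinearMap.add_compLpL, add_apply, add_apply, ContinuousLinearMap.comp_apply,
    ContinuousLinearMap.comp_apply, ContinuousLinearMap.comp_apply, add_apply]
  abel

lemma tipLoad_prim (h : L2 T) : tipLoad (ℓ := ℓ) (prim ℝ T h) = prim (L2 ℓ) T (tipLoad h) :=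
  (prim_compLp _ _).symm

variable (T) in
/-- The solution operator of the beam equation, in terms of the derivative of the load. -/
lemma exists_solution_operator (hc : 0 < c) (hρ : ∀ᵐ x ∂vol[ℓ], 0 ≤ mρ x)
    (hμ : ∀ᵐ x ∂vol[ℓ], 0 ≤ mμ x) (hr : ∀ᵐ x ∂vol[ℓ], 0 ≤ mr x) (hκ : ∀ᵐ x ∂vol[ℓ], c ≤ mκ x) :
    ∃ D : L2 T →L[ℝ] Lp (L2 ℓ) 2 vol[T], ∀ h,
      beamOp mρ mμ mr mκ (evolutionOf (D h)) = tipLoad (prim ℝ T h) := by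
  obtain ⟨D, hD⟩ := exists_evolOp_solution (b := T) (P := inertiaOp mρ)
    (Q := mulOp mκ + inertiaOp mμ) (R := mulOp mr) hc inertiaOp_symm (inertiaOp_nonneg hρ)
    (fun x y => by
      simp only [add_apply, inner_add_left, inner_add_right, inner_mulOp_symm, inertiaOp_symm])
    (fun x => by
      rw [add_apply, inner_add_left]
      exact (le_inner_mulOp mκ hκ x).trans (le_add_of_nonneg_right (inertiaOp_nonneg hμ x)))
    (inner_mulOp_symm mr) (mulOp_nonneg hr)
  refine ⟨D ∘L (ContinuousLinearMap.toSpanSingleton ℝ (tipL2 ℓ)).compLpL 2 vol[T], fun h => ?_⟩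
  rw [beamOp_evolutionOf, ContinuousLinearMap.comp_apply, hD, tipLoad_prim]
  rfl

lemma evolutionOf_deriv (ζ : Lp (L2 ℓ) 2 vol[T]) :
    (evolutionOf ζ).1 = prim (V ℓ) T (evolutionOf ζ).2.1 := (prim_compLp _ _).symm

lemma evolutionOf_deriv_fn (ζ : Lp (L2 ℓ) 2 vol[T]) :
    (fnL ℓ).compLpL 2 vol[T] (evolutionOf ζ).2.1 = prim (L2 ℓ) T (evolutionOf ζ).2.2 := by
  rw [evolutionOf, compLpL_comp, fnL_comp_lift, prim_compLp]

lemma beamOp_sub (s s' : Evolution ℓ T) :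
    beamOp mρ mμ mr mκ (s - s') = beamOp mρ mμ mr mκ s - beamOp mρ mμ mr mκ s' := by
  simp only [beamOp, Prod.fst_sub, Prod.snd_sub, map_sub]
  abel

/-- The homogeneous problem has only the trivial solution. -/
lemma eq_zero_of_beamOp_eq_zero (hc : 0 < c) (hρ : ∀ᵐ x ∂vol[ℓ], 0 ≤ mρ x)
    (hμ : ∀ᵐ x ∂vol[ℓ], 0 ≤ mμ x) (hr : ∀ᵐ x ∂vol[ℓ], 0 ≤ mr x) (hκ : ∀ᵐ x ∂vol[ℓ], c ≤ mκ x)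
    (s : Evolution ℓ T) (h1 : s.1 = prim (V ℓ) T s.2.1)
    (h2 : (fnL ℓ).compLpL 2 vol[T] s.2.1 = prim (L2 ℓ) T s.2.2)
    (h3 : beamOp mρ mμ mr mκ s = 0) : s = 0 := by
  obtain ⟨u, a, p⟩ := s
  simp only at h1 h2
  rw [beamOp_eq, h1, ← prim_compLp] at h3
  have hfn : (int2 ℓ).compLpL 2 vol[T] ((dxxL ℓ).compLpL 2 vol[T] a) = prim (L2 ℓ) T p := by
    rw [← h2, compLpL_comp, fnL_eq]
  have hlift := lift_dxx_compLpL a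
  -- A weak solution has `u_tt` only in `L²(0,T;L²(0,ℓ))`, so it need not come from some `ζ`. The
  -- energy test therefore keeps `z = u_xxt` and `p = u_tt` separate; tested with `u_t = ∂ₜ⁻¹p`, the
  -- inertia term is the nonnegative `⟨ρ p, ∂ₜ⁻¹p⟩`.
  generalize (dxxL ℓ).compLpL 2 vol[T] a = z at *
  have h4 := congrArg (fun f => inner ℝ f z) h3
  simp only [inner_add_left, inner_compLp_adjoint, hfn, inner_zero_left] at h4
  have p1 := inner_compLp_prim_nonneg (mulOp mρ) (inner_mulOp_symm mρ) (mulOp_nonneg hρ) p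
  have p2 := le_inner_compLp (inertiaOp mμ) 0 (fun x => by simpa using inertiaOp_nonneg hμ x) z
  have p3 := inner_compLp_prim_nonneg (mulOp mr) (inner_mulOp_symm mr) (mulOp_nonneg hr) z
  rw [inner_compLp_symm _ (inner_mulOp_symm mr), real_inner_comm] at p3
  have p4 := le_inner_compLp (mulOp mκ) c (le_inner_mulOp mκ hκ) z
  have hz0 : z = 0 := by
    have : ‖z‖ ^ 2 ≤ 0 := by
      by_contra! h0
      nlinarith
    exact norm_eq_zero.1 (pow_eq_zero_iff two_ne_zero |>.1 (le_antisymm this (by positivity)))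
  have ha : a = 0 := by rw [← hlift, hz0, map_zero]
  have hp : p = 0 := prim_injective (by rw [← h2, ha, map_zero])
  rw [h1, ha, hp, map_zero]
  rfl

lemma solution_unique (hc : 0 < c) (hρ : ∀ᵐ x ∂vol[ℓ], 0 ≤ mρ x)
    (hμ : ∀ᵐ x ∂vol[ℓ], 0 ≤ mμ x) (hr : ∀ᵐ x ∂vol[ℓ], 0 ≤ mr x) (hκ : ∀ᵐ x ∂vol[ℓ], c ≤ mκ x)
    {s s' : Evolution ℓ T} (h1 : s.1 = prim (V ℓ) T s.2.1)
    (h2 : (fnL ℓ).compLpL 2 vol[T] s.2.1 = prim (L2 ℓ) T s.2.2)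
    (h1' : s'.1 = prim (V ℓ) T s'.2.1)
    (h2' : (fnL ℓ).compLpL 2 vol[T] s'.2.1 = prim (L2 ℓ) T s'.2.2)
    (h3 : beamOp mρ mμ mr mκ s = beamOp mρ mμ mr mκ s') : s = s' := by
  rw [← sub_eq_zero]
  refine eq_zero_of_beamOp_eq_zero hc hρ hμ hr hκ _ ?_ ?_ ?_
  · rw [Prod.fst_sub, Prod.snd_sub, Prod.fst_sub, map_sub, ← h1, ← h1']
  · rw [Prod.snd_sub, Prod.fst_sub, Prod.snd_sub, map_sub, map_sub, h2, h2']
  · rw [beamOp_sub, h3, sub_self]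

end WellPosedness

/-! ### Invertibility of Volterra operators in Banach-valued `L²`. -/

section Volterra

variable {E : Type*} [NormedAddCommGroup E] [NormedSpace ℝ E] [CompleteSpace E] {b : ℝ}

/-- The Volterra operator `f ↦ A ∫₀ᵗ f`. -/
def volterra (b : ℝ) (A : E →L[ℝ] E) : Lp E 2 vol[b] →L[ℝ] Lp E 2 vol[b] :=
  A.compLpL 2 vol[b] ∘L prim E b

lemma coeFn_volterra (A : E →L[ℝ] E) (f : Lp E 2 vol[b]) :
    volterra b A f =ᵐ[vol[b]] fun t => A (primitive f t) := by
  filter_upwards [A.coeFn_compLpL (p := 2) (μ := vol[b]) (prim E b f), coeFn_prim f] with t h1 h2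
  rw [volterra, ContinuousLinearMap.comp_apply, h1, h2]

/-- The first application turns the `L¹` norm of `f` into a pointwise bound, and each later one
integrates `tⁿ/n!` once more; hence the shift to the power `n + 1`. -/
lemma ae_norm_volterra_pow_le (A : E →L[ℝ] E) (f : Lp E 2 vol[b]) (n : ℕ) :
    ∀ᵐ t ∂vol[b], ‖((volterra b A) ^ (n + 1)) f t‖ ≤
      ‖A‖ ^ (n + 1) * (∫ x, ‖f x‖ ∂vol[b]) * (t ^ n / n.factorial) := by
  set I := ∫ x, ‖f x‖ ∂vol[b] with hI
  have hI0 : 0 ≤ I := integral_nonneg fun _ => norm_nonneg _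
  induction n with
  | zero =>
    filter_upwards [coeFn_volterra A f, ae_norm_primitive_le f] with t h1 h2
    rw [zero_add, pow_one, h1]
    simpa using (A.le_opNorm _).trans (mul_le_mul_of_nonneg_left h2 (norm_nonneg _))
  | succ n ih =>
    set F := ((volterra b A) ^ (n + 1)) f with hF
    have hs : ((volterra b A) ^ (n + 1 + 1)) f = volterra b A F := by
      rw [pow_succ', mul_apply_eq_comp]
    rw [hs]
    filter_upwards [coeFn_volterra A F, ae_restrict_mem measurableSet_Ioo] with t h1 ht
    rw [h1]
    have h2 : ‖primitive F t‖ ≤ ∫ s in (0 : ℝ)..t, ‖A‖ ^ (n + 1) * I * (s ^ n / n.factorial) := by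
      rw [primitive_eq F ⟨ht.1.le, ht.2.le⟩]
      refine intervalIntegral.norm_integral_le_of_norm_le ht.1.le ?_
        (by apply Continuous.intervalIntegrable; fun_prop)
      have hsub : Ioc (0 : ℝ) t ⊆ Ioo 0 b := fun s hs => ⟨hs.1, hs.2.trans_lt ht.2⟩
      exact (ae_restrict_iff' measurableSet_Ioc).1 (ae_restrict_of_ae_restrict_of_subset hsub ih)
    rw [intervalIntegral.integral_const_mul, intervalIntegral.integral_div, integral_pow] at h2
    refine (A.le_opNorm _).trans ((mul_le_mul_of_nonneg_left h2 (norm_nonneg _)).trans_eq ?_)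
    rw [Nat.factorial_succ]
    push_cast
    field_simp
    simp
    ring

lemma exists_norm_volterra_pow_lt_one (A : E →L[ℝ] E) :
    ∃ n : ℕ, ‖(volterra b A) ^ n‖ < 1 := by
  set M : ℝ := (vol[b]).real univ ^ (2 : ℝ≥0∞).toReal⁻¹ with hM
  set B : ℝ := max b 0 with hB
  have hbound : ∀ n : ℕ, ‖(volterra b A) ^ (n + 1)‖ ≤
      (M * ‖A‖ * B ^ (1 / 2 : ℝ)) * ((‖A‖ * B) ^ n / n.factorial) := by
    intro n
    refine ContinuousLinearMap.opNorm_le_bound _ (by positivity) fun f => ?_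
    have hI0 : 0 ≤ ∫ x, ‖f x‖ ∂vol[b] := integral_nonneg fun _ => norm_nonneg _
    have h1 := Lp.norm_le_of_ae_bound (f := ((volterra b A) ^ (n + 1)) f)
      (C := ‖A‖ ^ (n + 1) * (∫ x, ‖f x‖ ∂vol[b]) * (B ^ n / n.factorial)) (by positivity) (by
        filter_upwards [ae_norm_volterra_pow_le A f n, ae_restrict_mem measurableSet_Ioo]
          with t h1 ht
        refine h1.trans ?_
        have := ht.1.le
        have : t ≤ B := ht.2.le.trans (le_max_left _ _)
        gcongr)
    refine h1.trans ?_
    have h2 := norm_integral_norm_le f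
    simp only [measureUnivNNReal]
    change M * _ ≤ _
    calc M * (‖A‖ ^ (n + 1) * (∫ x, ‖f x‖ ∂vol[b]) * (B ^ n / n.factorial))
        ≤ M * (‖A‖ ^ (n + 1) * (B ^ (1 / 2 : ℝ) * ‖f‖) * (B ^ n / n.factorial)) := by gcongr
      _ = _ := by rw [mul_pow, pow_succ]; ring
  have hlim := (FloorSemiring.tendsto_pow_div_factorial_atTop (‖A‖ * B)).const_mul
    (M * ‖A‖ * B ^ (1 / 2 : ℝ))
  rw [mul_zero] at hlim
  obtain ⟨n, hn⟩ := (hlim.eventually (gt_mem_nhds one_pos)).exists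
  exact ⟨n + 1, (hbound n).trans_lt hn⟩

/-- Some power of `N` is a strict contraction, so `1 - (-N)ⁿ` is a unit. It is the product of `1 +
N` with a commuting geometric sum, so `1 + N` is a unit too. No inner product on `E` is needed, so
sup-norm spaces are covered. -/
lemma isUnit_one_add_volterra (A : E →L[ℝ] E) : IsUnit (1 + volterra b A) := by
  obtain ⟨n, hn⟩ := exists_norm_volterra_pow_lt_one (b := b) A
  set N := volterra b A
  have h1 : IsUnit (1 - (-N) ^ n) := by
    apply isUnit_one_sub_of_norm_lt_one
    rcases n.even_or_odd with h | h
    · rwa [h.neg_pow]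
    · rwa [h.neg_pow, norm_neg]
  rw [← mul_neg_geom_sum] at h1
  have hcomm : Commute (1 - -N) (∑ i ∈ Finset.range n, (-N) ^ i) :=
    (Commute.one_left _).sub_left (Commute.sum_right _ _ _ fun i _ => Commute.self_pow _ _)
  rw [hcomm.isUnit_mul_iff, sub_neg_eq_add] at h1
  exact h1.1

end Volterra

/-! ### Spatial continuity of `u_xx` and `u_xxt`. -/

section ContinuousRepresentatives

variable {ℓ T c : ℝ}

variable (ℓ) in
/-- The `L²` class of a bounded continuous function. -/
abbrev bcfToL2 : (ℝ →ᵇ ℝ) →L[ℝ] L2 ℓ := BoundedContinuousFunction.toLp 2 vol[ℓ] ℝ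

lemma norm_primitive_le_integral (f : L2 ℓ) (t : ℝ) : ‖primitive f t‖ ≤ ∫ x, ‖f x‖ ∂vol[ℓ] :=
  (intervalIntegral.norm_integral_le_integral_norm_uIoc).trans
    (setIntegral_le_integral (integrable_of_L2 f).norm (ae_of_all _ fun _ => norm_nonneg _))

lemma norm_tail_le (q : L2 ℓ) (x : ℝ) :
    ‖(∫ y, q y ∂vol[ℓ]) - primitive q x‖ ≤ 2 * ∫ x, ‖q x‖ ∂vol[ℓ] := by
  rw [two_mul]
  exact (norm_sub_le _ _).trans
    (add_le_add (norm_integral_le_integral_norm _) (norm_primitive_le_integral q x))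

variable (ℓ) in
/-- The operator `q ↦ ∫ₓ^ℓ q`, with values in the bounded continuous functions. -/
def tailIntegral : L2 ℓ →L[ℝ] (ℝ →ᵇ ℝ) :=
  LinearMap.mkContinuous
    { toFun := fun q => BoundedContinuousFunction.ofNormedAddCommGroup
        (fun x => (∫ y, q y ∂vol[ℓ]) - primitive q x)
        (continuous_const.sub (continuous_primitive q)) (2 * ∫ x, ‖q x‖ ∂vol[ℓ])
        (norm_tail_le q)
      map_add' := fun f g => by
        ext x
        have := integral_add (integrable_of_L2 f) (integrable_of_L2 g)
        simp only [BoundedContinuousFunction.coe_ofNormedAddCommGroup, primitive_add, Pi.add_apply,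
          BoundedContinuousFunction.coe_add]
        rw [integral_congr_ae (Lp.coeFn_add f g)]
        simp only [Pi.add_apply, this]
        ring
      map_smul' := fun k f => by
        ext x
        simp only [BoundedContinuousFunction.coe_ofNormedAddCommGroup, primitive_smul,
          Pi.smul_apply, BoundedContinuousFunction.coe_smul, RingHom.id_apply]
        rw [integral_congr_ae (Lp.coeFn_smul k f)]
        simp only [Pi.smul_apply, integral_smul, smul_sub] }
    (2 * (max ℓ 0) ^ (1 / 2 : ℝ)) (fun q => by
      have h0 : 0 ≤ ∫ x, ‖q x‖ ∂vol[ℓ] := integral_nonneg fun _ => norm_nonneg _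
      refine (BoundedContinuousFunction.norm_ofNormedAddCommGroup_le _
        (mul_nonneg zero_le_two h0) (norm_tail_le q)).trans ?_
      rw [mul_assoc]
      have := norm_integral_norm_le q
      gcongr)

lemma tailIntegral_apply (q : L2 ℓ) (x : ℝ) :
    tailIntegral ℓ q x = (∫ y, q y ∂vol[ℓ]) - primitive q x := rfl

lemma bcfToL2_comp_tailIntegral : bcfToL2 ℓ ∘L tailIntegral ℓ = primAdj ℝ ℓ := by
  ext1 q
  apply Lp.ext
  filter_upwards [BoundedContinuousFunction.coeFn_toLp (p := 2) vol[ℓ] ℝ (tailIntegral ℓ q),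
    coeFn_primAdj q] with x h1 h2
  rw [h2, ContinuousLinearMap.comp_apply, h1, tailIntegral_apply]

lemma bcfToL2_mul {m : Lp ℝ ∞ vol[ℓ]} {k : ℝ →ᵇ ℝ} (hm : m =ᵐ[vol[ℓ]] k) :
    bcfToL2 ℓ ∘L ContinuousLinearMap.mul ℝ (ℝ →ᵇ ℝ) k = mulOp m ∘L bcfToL2 ℓ := by
  ext1 f
  apply Lp.ext
  filter_upwards [BoundedContinuousFunction.coeFn_toLp (p := 2) vol[ℓ] ℝ (k * f), hm,
    BoundedContinuousFunction.coeFn_toLp (p := 2) vol[ℓ] ℝ f, coeFn_mulOp m (bcfToL2 ℓ f)]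
    with x h1 h2 h3 h4
  simp only [ContinuousLinearMap.comp_apply, ContinuousLinearMap.mul_apply']
  rw [h4, h1, h2, h3]
  rfl

lemma isContRep_bcfToL2 (f : ℝ →ᵇ ℝ) : IsContRep ℓ (bcfToL2 ℓ f) f :=
  ⟨f.continuous.continuousOn, BoundedContinuousFunction.coeFn_toLp (p := 2) vol[ℓ] ℝ f⟩

lemma bcf_isUnit (hc : 0 < c) {k : ℝ →ᵇ ℝ} (hk : ∀ x, c ≤ k x) : ∃ k' : ℝ →ᵇ ℝ, k * k' = 1 := by
  have hpos : ∀ x, 0 < k x := fun x => hc.trans_le (hk x)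
  refine ⟨BoundedContinuousFunction.ofNormedAddCommGroup (fun x => (k x)⁻¹)
    (k.continuous.inv₀ fun x => (hpos x).ne') c⁻¹ fun x => ?_, ?_⟩
  · rw [norm_inv, Real.norm_of_nonneg (hpos x).le]
    exact inv_anti₀ hc (hk x)
  · ext x
    exact mul_inv_cancel₀ (hpos x).ne'

/-- Solutions of `κ z + r ∫₀ᵗ z = M`, with `M` continuous in space, are continuous in space. -/
lemma exists_continuous_solution (hc : 0 < c) {mr mκ : Lp ℝ ∞ vol[ℓ]} {r κ : ℝ →ᵇ ℝ}
    (hr : mr =ᵐ[vol[ℓ]] r) (hκ : mκ =ᵐ[vol[ℓ]] κ) (hr0 : ∀ᵐ x ∂vol[ℓ], 0 ≤ mr x)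
    (hκ0 : ∀ x, c ≤ κ x) (q z : Lp (L2 ℓ) 2 vol[T])
    (hz : (mulOp mr).compLpL 2 vol[T] (prim (L2 ℓ) T z) + (mulOp mκ).compLpL 2 vol[T] z =
      (primAdj ℝ ℓ).compLpL 2 vol[T] q) :
    ∃ y : Lp (ℝ →ᵇ ℝ) 2 vol[T],
      z = (bcfToL2 ℓ).compLpL 2 vol[T] y ∧
      (ContinuousLinearMap.mul ℝ (ℝ →ᵇ ℝ) r).compLpL 2 vol[T] (prim (ℝ →ᵇ ℝ) T y) +
        (ContinuousLinearMap.mul ℝ (ℝ →ᵇ ℝ) κ).compLpL 2 vol[T] y =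
        (tailIntegral ℓ).compLpL 2 vol[T] q := by
  obtain ⟨κ', hκ'⟩ := bcf_isUnit hc hκ0
  set mul := ContinuousLinearMap.mul ℝ (ℝ →ᵇ ℝ) with hmul
  have hmm : ∀ k k', mul k ∘L mul k' = mul (k * k') := fun k k' => by
    ext1 f; simp [hmul, mul_assoc]
  obtain ⟨Y, hY⟩ := (isUnit_one_add_volterra (b := T) (mul (κ' * r))).exists_right_inv
  -- `M` is the right-hand side taken in the sup-norm space. After division by `κ` the equation
  -- reads `y + (r/κ) ∂ₜ⁻¹y = M/κ`, solved by inverting the Volterra operator.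
  set M := (tailIntegral ℓ).compLpL 2 vol[T] q with hM
  set y := Y ((mul κ').compLpL 2 vol[T] M) with hy
  have h1 : y + (mul (κ' * r)).compLpL 2 vol[T] (prim (ℝ →ᵇ ℝ) T y)
      = (mul κ').compLpL 2 vol[T] M :=
    DFunLike.congr_fun hY ((mul κ').compLpL 2 vol[T] M)
  have hone : ∀ f : Lp (ℝ →ᵇ ℝ) 2 vol[T], (mul 1).compLpL 2 vol[T] f = f := fun f => by
    apply Lp.ext
    filter_upwards [(mul 1).coeFn_compLpL (p := 2) (μ := vol[T]) f] with t ht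
    rw [ht]; exact one_mul _
  have h2 : (mul r).compLpL 2 vol[T] (prim (ℝ →ᵇ ℝ) T y) + (mul κ).compLpL 2 vol[T] y = M := by
    have := congrArg ((mul κ).compLpL 2 vol[T]) h1
    rwa [map_add, compLpL_comp, compLpL_comp, hmm, hmm, ← mul_assoc, hκ', one_mul, hone,
      add_comm] at this
  refine ⟨y, ?_, h2⟩
  have h3 := congrArg ((bcfToL2 ℓ).compLpL 2 vol[T]) h2
  rw [map_add, compLpL_comp, compLpL_comp, hM, compLpL_comp, bcfToL2_comp_tailIntegral,
    bcfToL2_mul hr, bcfToL2_mul hκ, ← compLpL_comp, ← compLpL_comp, ← prim_compLp] at h3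
  set y' := (bcfToL2 ℓ).compLpL 2 vol[T] y with hy'
  have hκm : ∀ᵐ x ∂vol[ℓ], c ≤ mκ x := by
    filter_upwards [hκ] with x hx
    rw [hx]; exact hκ0 x
  rw [← sub_eq_zero]
  refine evolOp_injective (b := T) (P := (0 : L2 ℓ →L[ℝ] L2 ℓ)) (Q := mulOp mκ) (R := mulOp mr) hc
    -- The `L²` class of `y` satisfies the equation of `z`. One more integration in time puts the
    -- equation for the difference into the form `evolOp` with `P = 0`, where injectivity is known.
    (by simp) (by simp) (le_inner_mulOp mκ hκm) (inner_mulOp_symm mr) (mulOp_nonneg hr0) _ ?_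
  have h4 : evolOp T (0 : L2 ℓ →L[ℝ] L2 ℓ) (mulOp mκ) (mulOp mr) (z - y') =
      prim (L2 ℓ) T ((mulOp mr).compLpL 2 vol[T] (prim (L2 ℓ) T (z - y')) +
        (mulOp mκ).compLpL 2 vol[T] (z - y')) := by
    have h0 : (0 : L2 ℓ →L[ℝ] L2 ℓ).compLpL 2 vol[T] (z - y') = 0 := by
      apply Lp.ext
      filter_upwards [(0 : L2 ℓ →L[ℝ] L2 ℓ).coeFn_compLpL (p := 2) (μ := vol[T]) (z - y'),
        Lp.coeFn_zero (L2 ℓ) 2 vol[T]] with t h1 h2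
      rw [h1, h2]; rfl
    rw [evolOp, add_apply, add_apply, h0, zero_add, map_add, prim_compLp, prim_compLp, add_comm]
    rfl
  rw [h4, map_sub, map_sub, map_sub, sub_add_sub_comm, hz, h3, sub_self, map_zero]

end ContinuousRepresentatives

/-! ### Coefficients as multipliers. -/

section Coefficients

variable {ℓ : ℝ}

lemma HasL2Deriv.continuousOn {f f' : ℝ → ℝ} (h : HasL2Deriv ℓ f f') :
    ContinuousOn f (Icc 0 ℓ) := by
  obtain ⟨h1, h2⟩ := h
  have hc : Continuous fun x => f 0 + primitive h1.toLp x :=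
    continuous_const.add (continuous_primitive _)
  refine hc.continuousOn.congr fun x hx => ?_
  change f x = f 0 + primitive h1.toLp x
  rw [h2 x hx, primitive_eq _ hx]
  congr 1
  rw [intervalIntegral.integral_of_le hx.1, intervalIntegral.integral_of_le hx.1,
    integral_Ioc_eq_integral_Ioo, integral_Ioc_eq_integral_Ioo]
  exact integral_congr_ae (ae_restrict_of_ae_restrict_of_subset (Ioo_subset_Ioo_right hx.2)
    h1.coeFn_toLp.symm)

lemma exists_bcf_extension (hℓ : 0 < ℓ) {f : ℝ → ℝ} (hf : ContinuousOn f (Icc 0 ℓ)) {a B : ℝ}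
    (hb : ∀ x ∈ Icc 0 ℓ, a ≤ f x ∧ f x ≤ B) :
    ∃ k : ℝ →ᵇ ℝ, EqOn f k (Icc 0 ℓ) ∧ ∀ x, a ≤ k x := by
  refine ⟨BoundedContinuousFunction.ofNormedAddCommGroup
    (IccExtend hℓ.le ((Icc 0 ℓ).domRestrict f)) hf.domRestrict.Icc_extend' (max |a| |B|) fun x => ?_,
    fun x hx => ?_, fun x => ?_⟩
  · have := hb _ (projIcc 0 ℓ hℓ.le x).2
    exact abs_le_max_abs_abs this.1 this.2
  · exact (IccExtend_of_mem hℓ.le ((Icc 0 ℓ).domRestrict f) hx).symm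
  · exact (hb _ (projIcc 0 ℓ hℓ.le x).2).1

lemma exists_Linfty_class {f : ℝ → ℝ} (hf : AEStronglyMeasurable f vol[ℓ]) {a B : ℝ}
    (hb : ∀ᵐ x ∂vol[ℓ], a ≤ f x ∧ f x ≤ B) :
    ∃ m : Lp ℝ ∞ vol[ℓ], f =ᵐ[vol[ℓ]] m ∧ ∀ᵐ x ∂vol[ℓ], a ≤ m x := by
  have hm : MemLp f ∞ vol[ℓ] := memLp_top_of_bound hf (max |a| |B|) (by
    filter_upwards [hb] with x hx
    exact abs_le_max_abs_abs hx.1 hx.2)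
  refine ⟨hm.toLp, hm.coeFn_toLp.symm, ?_⟩
  filter_upwards [hm.coeFn_toLp, hb] with x h1 h2
  rw [h1]
  exact h2.1

/-- The continuous extension acts on continuous functions and the `L^∞` class on `L²`. The lower
bound on all of `ℝ` allows division by `κ`, and the value at `0` is kept because it enters `Ψ`. -/
lemma exists_bcf_Linfty_class (hℓ : 0 < ℓ) {f : ℝ → ℝ} (hf : MemH2 ℓ f) {a B : ℝ}
    (hb : ∀ x ∈ Icc 0 ℓ, a ≤ f x ∧ f x ≤ B) :
    ∃ (k : ℝ →ᵇ ℝ) (m : Lp ℝ ∞ vol[ℓ]), (∀ x, a ≤ k x) ∧ f 0 = k 0 ∧ m =ᵐ[vol[ℓ]] k ∧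
      f =ᵐ[vol[ℓ]] m ∧ ∀ᵐ x ∂vol[ℓ], a ≤ m x := by
  obtain ⟨f', _, hf', _⟩ := hf
  obtain ⟨k, hk, hka⟩ := exists_bcf_extension hℓ hf'.continuousOn hb
  have hae : f =ᵐ[vol[ℓ]] k := by
    filter_upwards [ae_restrict_mem measurableSet_Ioo] with x hx
    exact hk (Ioo_subset_Icc_self hx)
  obtain ⟨m, hm, hma⟩ := exists_Linfty_class
    (k.continuous.aestronglyMeasurable.congr hae.symm) (a := a) (B := B) (by
      filter_upwards [ae_restrict_mem measurableSet_Ioo] with x hx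
      exact hb x (Ioo_subset_Icc_self hx))
  exact ⟨k, m, hka, hk ⟨le_rfl, hℓ.le⟩, hm.symm.trans hae, hm, hma⟩

end Coefficients

/-! ### Reduction of the control problem to the derivative of the load. -/

section Admissible

variable {T C : ℝ}

variable (T C) in
/-- The derivatives of the admissible loads. -/
def admissibleDeriv : Set (L2 T) := {h | ‖prim ℝ T h‖ ^ 2 + ‖h‖ ^ 2 ≤ C ^ 2}

lemma admissible_eq (hC : 0 < C) : admissible T C = prim ℝ T '' admissibleDeriv T C := by
  ext g
  simp only [admissible, admissibleDeriv, mem_ofPred_eq, mem_image, hasWeakDerivFrom_Lp_iff]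
  constructor
  · rintro ⟨h, rfl, hh⟩
    exact ⟨h, (Real.sqrt_le_left hC.le).1 hh, rfl⟩
  · rintro ⟨h, hh, rfl⟩
    exact ⟨h, rfl, (Real.sqrt_le_left hC.le).2 hh⟩

/-- In the variable `h = g'` the `H¹` ball is closed, convex and contained in the `L²` ball of
radius `C`, and the functional is half the squared residual of the bounded linear map `A`. -/
lemma exists_isMinOn_admissible (hC : 0 < C) (A : L2 T →L[ℝ] L2 T) (ν : L2 T)
    (Λ : L2 T → ℝ → ℝ) (hΛ : ∀ h, Λ (prim ℝ T h) =ᵐ[vol[T]] A h) :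
    ∃ g ∈ admissible T C,
      IsMinOn (fun g => 1 / 2 * ∫ t in Ioo 0 T, (Λ g t - ν t) ^ 2) (admissible T C) g := by
  have hcont : Continuous fun h : L2 T => ‖prim ℝ T h‖ ^ 2 + ‖h‖ ^ 2 := by fun_prop
  have hconv : ConvexOn ℝ univ fun h : L2 T => ‖prim ℝ T h‖ ^ 2 + ‖h‖ ^ 2 := by
    have h1 : ConvexOn ℝ univ fun h : L2 T => ‖h‖ ^ 2 :=
      (convexOn_norm convex_univ).pow (fun _ _ => norm_nonneg _) 2
    exact (h1.comp_linearMap (prim ℝ T).toLinearMap).add h1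
  obtain ⟨h, hh, hmin⟩ := exists_isMinOn_norm_sub (admissibleDeriv T C)
    ⟨0, by simp only [admissibleDeriv, mem_ofPred_eq, map_zero, norm_zero]; nlinarith⟩
    (isClosed_le hcont continuous_const)
    (by simpa [admissibleDeriv] using hconv.convex_le (C ^ 2)) C
    (fun h hh => abs_le_of_sq_le_sq' (by
      have : ‖prim ℝ T h‖ ^ 2 + ‖h‖ ^ 2 ≤ C ^ 2 := hh
      nlinarith [sq_nonneg ‖prim ℝ T h‖]) hC.le |>.2) A ν
  have hval : ∀ h, ∫ t in Ioo 0 T, (Λ (prim ℝ T h) t - ν t) ^ 2 = ‖A h - ν‖ ^ 2 := by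
    intro h
    rw [← real_inner_self_eq_norm_sq, L2.inner_def]
    refine integral_congr_ae ?_
    filter_upwards [hΛ h, Lp.coeFn_sub (A h) ν] with t h1 h2
    rw [h1, h2, Pi.sub_apply, RCLike.inner_apply, conj_trivial, sq]
  rw [admissible_eq hC]
  refine ⟨_, mem_image_of_mem _ hh, ?_⟩
  rintro _ ⟨k, hk, rfl⟩
  simp only [mem_ofPred_eq, hval]
  have := hmin hk
  simp only [mem_ofPred_eq] at this
  gcongr

end Admissible

/-! ### The outputs as bounded linear functions of `h`. -/

section Outputs

variable {ℓ T c : ℝ} {mρ mμ mr mκ : Lp ℝ ∞ vol[ℓ]}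

/-- The function `q` for which the bending moment is `x ↦ ∫ₓ^ℓ q`. -/
def shearOp (mρ mμ : Lp ℝ ∞ vol[ℓ]) (D : L2 T →L[ℝ] Lp (L2 ℓ) 2 vol[T]) :
    L2 T →L[ℝ] Lp (L2 ℓ) 2 vol[T] :=
  -- With `ζ = D h` and `g = ∂ₜ⁻¹h` this is `q = g - ∫ₓ^ℓ (ρ u_tt + μ u_t)`: the equation integrated
  -- once in space, with the shear condition at `ℓ`.
  (ContinuousLinearMap.toSpanSingleton ℝ (oneL2 ℓ)).compLpL 2 vol[T] ∘L prim ℝ T -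
    (primAdj ℝ ℓ ∘L mulOp mρ ∘L int2 ℓ).compLpL 2 vol[T] ∘L D -
    (primAdj ℝ ℓ ∘L mulOp mμ ∘L int2 ℓ).compLpL 2 vol[T] ∘L prim (L2 ℓ) T ∘L D

lemma shearOp_apply (D : L2 T →L[ℝ] Lp (L2 ℓ) 2 vol[T]) (h : L2 T) :
    shearOp mρ mμ D h =
      (ContinuousLinearMap.toSpanSingleton ℝ (oneL2 ℓ)).compLpL 2 vol[T] (prim ℝ T h) -
      (primAdj ℝ ℓ ∘L mulOp mρ ∘L int2 ℓ).compLpL 2 vol[T] (D h) -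
      (primAdj ℝ ℓ ∘L mulOp mμ ∘L int2 ℓ).compLpL 2 vol[T] (prim (L2 ℓ) T (D h)) := rfl

lemma evolOp_apply (P Q R : L2 ℓ →L[ℝ] L2 ℓ) (ζ : Lp (L2 ℓ) 2 vol[T]) :
    evolOp T P Q R ζ = P.compLpL 2 vol[T] ζ + Q.compLpL 2 vol[T] (prim (L2 ℓ) T ζ) +
      R.compLpL 2 vol[T] (prim (L2 ℓ) T (prim (L2 ℓ) T ζ)) := rfl

lemma primAdj_comp_inertia (m : Lp ℝ ∞ vol[ℓ]) :
    primAdj ℝ ℓ ∘L primAdj ℝ ℓ ∘L mulOp m ∘L int2 ℓ = inertiaOp m := by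
  have h : (int2 ℓ).adjoint = primAdj ℝ ℓ ∘L primAdj ℝ ℓ := ContinuousLinearMap.adjoint_comp _ _
  rw [inertiaOp, h, ContinuousLinearMap.comp_assoc]

/-- The bending moment is the tail integral of the shear force. -/
lemma moment_eq (D : L2 T →L[ℝ] Lp (L2 ℓ) 2 vol[T]) (h : L2 T)
    (hD : beamOp mρ mμ mr mκ (evolutionOf (D h)) = tipLoad (prim ℝ T h)) :
    (mulOp mr).compLpL 2 vol[T] (prim (L2 ℓ) T (prim (L2 ℓ) T (D h))) +
      (mulOp mκ).compLpL 2 vol[T] (prim (L2 ℓ) T (D h)) =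
      (primAdj ℝ ℓ).compLpL 2 vol[T] (shearOp mρ mμ D h) := by
  have htip : primAdj ℝ ℓ ∘L ContinuousLinearMap.toSpanSingleton ℝ (oneL2 ℓ) =
      ContinuousLinearMap.toSpanSingleton ℝ (tipL2 ℓ) := by
    ext1; simp [tipL2]
  have hq : (primAdj ℝ ℓ).compLpL 2 vol[T] (shearOp mρ mμ D h) = tipLoad (prim ℝ T h) -
      (inertiaOp mρ).compLpL 2 vol[T] (D h) -
      (inertiaOp mμ).compLpL 2 vol[T] (prim (L2 ℓ) T (D h)) := by
    have e1 := compLpL_comp (ContinuousLinearMap.toSpanSingleton ℝ (oneL2 ℓ)) (primAdj ℝ ℓ)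
      (prim ℝ T h)
    have e2 := compLpL_comp (primAdj ℝ ℓ ∘L mulOp mρ ∘L int2 ℓ) (primAdj ℝ ℓ) (D h)
    have e3 := compLpL_comp (primAdj ℝ ℓ ∘L mulOp mμ ∘L int2 ℓ) (primAdj ℝ ℓ)
      (prim (L2 ℓ) T (D h))
    rw [htip] at e1
    rw [primAdj_comp_inertia] at e2 e3
    rw [shearOp_apply, map_sub, map_sub, e1, e2, e3, tipLoad]
  rw [hq, ← hD, beamOp_evolutionOf, evolOp_apply, ContinuousLinearMap.add_compLpL, add_apply]
  abel

/-- Continuity in space, and the value at `0` of the bending moment. -/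
lemma exists_contRep_dxx (hc : 0 < c) {r κ : ℝ →ᵇ ℝ}
    (hr : mr =ᵐ[vol[ℓ]] r) (hκ : mκ =ᵐ[vol[ℓ]] κ) (hr0 : ∀ᵐ x ∂vol[ℓ], 0 ≤ mr x)
    (hκ0 : ∀ x, c ≤ κ x) (ζ q : Lp (L2 ℓ) 2 vol[T])
    (hq : (mulOp mr).compLpL 2 vol[T] (prim (L2 ℓ) T (prim (L2 ℓ) T ζ)) +
      (mulOp mκ).compLpL 2 vol[T] (prim (L2 ℓ) T ζ) = (primAdj ℝ ℓ).compLpL 2 vol[T] q) :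
    ∀ᵐ t ∂vol[T], ∃ F G : ℝ → ℝ, IsContRep ℓ (dxx ((evolutionOf ζ).1 t)) F ∧
      IsContRep ℓ (dxx ((evolutionOf ζ).2.1 t)) G ∧
      r 0 * F 0 + κ 0 * G 0 = inner ℝ (oneL2 ℓ) (q t) := by
  obtain ⟨y, hy, hM⟩ := exists_continuous_solution hc hr hκ hr0 hκ0 q _ hq
  have h1 : (dxxL ℓ).compLpL 2 vol[T] (evolutionOf ζ).1 =
      (bcfToL2 ℓ).compLpL 2 vol[T] (prim (ℝ →ᵇ ℝ) T y) := by
    rw [evolutionOf, dxx_lift_compLpL, hy, prim_compLp]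
  have h2 : (dxxL ℓ).compLpL 2 vol[T] (evolutionOf ζ).2.1 = (bcfToL2 ℓ).compLpL 2 vol[T] y := by
    rw [evolutionOf, dxx_lift_compLpL, hy]
  have k1 := (dxxL ℓ).coeFn_compLpL (p := 2) (μ := vol[T]) (evolutionOf ζ).1
  have k2 := (dxxL ℓ).coeFn_compLpL (p := 2) (μ := vol[T]) (evolutionOf ζ).2.1
  have k3 := (tailIntegral ℓ).coeFn_compLpL (p := 2) (μ := vol[T]) q
  rw [h1] at k1
  rw [h2] at k2
  rw [← hM] at k3
  filter_upwards [k1, k2, k3,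
    (bcfToL2 ℓ).coeFn_compLpL (p := 2) (μ := vol[T]) (prim (ℝ →ᵇ ℝ) T y),
    (bcfToL2 ℓ).coeFn_compLpL (p := 2) (μ := vol[T]) y,
    Lp.coeFn_add ((ContinuousLinearMap.mul ℝ (ℝ →ᵇ ℝ) r).compLpL 2 vol[T] (prim (ℝ →ᵇ ℝ) T y))
      ((ContinuousLinearMap.mul ℝ (ℝ →ᵇ ℝ) κ).compLpL 2 vol[T] y),
    (ContinuousLinearMap.mul ℝ (ℝ →ᵇ ℝ) r).coeFn_compLpL (p := 2) (μ := vol[T])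
      (prim (ℝ →ᵇ ℝ) T y),
    (ContinuousLinearMap.mul ℝ (ℝ →ᵇ ℝ) κ).coeFn_compLpL (p := 2) (μ := vol[T]) y]
    with t a1 a2 a3 b1 b2 b3 b4 b5
  refine ⟨prim (ℝ →ᵇ ℝ) T y t, y t, ?_, ?_, ?_⟩
  · rw [← dxxL_apply, ← a1, b1]
    exact isContRep_bcfToL2 _
  · rw [← dxxL_apply, ← a2, b2]
    exact isContRep_bcfToL2 _
  · rw [b3, Pi.add_apply, b4, b5] at a3
    -- The tail integral at `x = 0` is the integral of `q t` over the whole beam, that is, the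
    -- pairing with `1`.
    have := DFunLike.congr_fun a3 0
    rw [tailIntegral_apply, primitive_zero_apply, sub_zero, ← inner_oneL2] at this
    exact this

lemma coeFn_innerSL_compLpL {X : Type*} [NormedAddCommGroup X] [InnerProductSpace ℝ X] (x : X)
    (f : Lp X 2 vol[T]) :
    (innerSL ℝ x).compLpL 2 vol[T] f =ᵐ[vol[T]] fun t => inner ℝ x (f t) :=
  (innerSL ℝ x).coeFn_compLpL f

lemma tip_trace_ae_eq (hℓ : 0 < ℓ) (ζ : Lp (L2 ℓ) 2 vol[T]) :
    (fun t => trace ℓ (fn ((evolutionOf ζ).1 t)) ℓ) =ᵐ[vol[T]]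
      (innerSL ℝ (tipL2 ℓ)).compLpL 2 vol[T] (prim (L2 ℓ) T (prim (L2 ℓ) T ζ)) := by
  have k := (dxxL ℓ).coeFn_compLpL (p := 2) (μ := vol[T]) (evolutionOf ζ).1
  rw [evolutionOf, dxx_lift_compLpL] at k
  filter_upwards [k, coeFn_innerSL_compLpL (tipL2 ℓ) (prim (L2 ℓ) T (prim (L2 ℓ) T ζ))] with t h1 h2
  rw [h2, h1, trace_fn hℓ]
  rfl

end Outputs

end Beam

end

/-! ### Assembly of the theorem. -/

theorem theorem3p1 (ℓ T C ρ₀ ρ₁ μ₀ μ₁ r₀ r₁ κ₀ κ₁ : ℝ) (ρ μ r κ : ℝ → ℝ)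
    (hℓ : 0 < ℓ) (hT : 0 < T) (hC : 0 < C)
    (hcoef : Beam.Coefficients ℓ ρ₀ ρ₁ μ₀ μ₁ r₀ r₁ κ₀ κ₁ ρ μ r κ)
    (ν ω : Beam.L2 T) :
    (∀ g ∈ Beam.admissible T C,
      (∃! s : Beam.Evolution ℓ T, Beam.IsWeakSolution ℓ T ρ μ r κ g s) ∧
      (∀ᵐ t ∂(volume.restrict (Ioo 0 T)),
        (∃ F, Beam.IsContRep ℓ (Beam.fn ((Beam.solution ℓ T ρ μ r κ g).1 t)) F) ∧
        (∃ F, Beam.IsContRep ℓ (Beam.dxx ((Beam.solution ℓ T ρ μ r κ g).1 t)) F) ∧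
        (∃ F, Beam.IsContRep ℓ (Beam.dxx ((Beam.solution ℓ T ρ μ r κ g).2.1 t)) F)) ∧
      MemLp (Beam.Phi ℓ T ρ μ r κ g) 2 (volume.restrict (Ioo 0 T)) ∧
      MemLp (Beam.Psi ℓ T ρ μ r κ g) 2 (volume.restrict (Ioo 0 T))) ∧
    (∃ g ∈ Beam.admissible T C, IsMinOn (Beam.J1 ℓ T ρ μ r κ ν) (Beam.admissible T C) g) ∧
    (∃ g ∈ Beam.admissible T C, IsMinOn (Beam.J2 ℓ T ρ μ r κ ω) (Beam.admissible T C) g) := by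
  open Beam in
  obtain ⟨mρ, hρ, hρ0⟩ := exists_Linfty_class hcoef.ρ_meas hcoef.ρ_bounds
  obtain ⟨mμ, hμ, hμ0⟩ := exists_Linfty_class hcoef.μ_meas hcoef.μ_bounds
  obtain ⟨rc, mr, -, hr00, hrc, hr, hr0⟩ := exists_bcf_Linfty_class hℓ hcoef.r_mem hcoef.r_bounds
  obtain ⟨κc, mκ, hκc0, hκ00, hκc, hκ, hκ0⟩ :=
    exists_bcf_Linfty_class hℓ hcoef.κ_mem hcoef.κ_bounds
  replace hρ0 : ∀ᵐ x ∂(volume.restrict (Ioo 0 ℓ)), 0 ≤ mρ x := by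
    filter_upwards [hρ0] with x hx using hcoef.ρ₀_pos.le.trans hx
  replace hμ0 : ∀ᵐ x ∂(volume.restrict (Ioo 0 ℓ)), 0 ≤ mμ x := by
    filter_upwards [hμ0] with x hx using hcoef.μ₀_nonneg.trans hx
  replace hr0 : ∀ᵐ x ∂(volume.restrict (Ioo 0 ℓ)), 0 ≤ mr x := by
    filter_upwards [hr0] with x hx using hcoef.r₀_pos.le.trans hx
  have hκpos := hcoef.κ₀_pos
  obtain ⟨D, hD⟩ := exists_solution_operator T hκpos hρ0 hμ0 hr0 hκ0
  have hiff := isWeakSolution_iff (T := T) hℓ hρ hμ hr hκ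
  have hex : ∀ h, IsWeakSolution ℓ T ρ μ r κ (prim ℝ T h) (evolutionOf (D h)) := fun h =>
    (hiff _ _).2 ⟨evolutionOf_deriv _, evolutionOf_deriv_fn _, hD h⟩
  have huniq : ∀ h s, IsWeakSolution ℓ T ρ μ r κ (prim ℝ T h) s → s = evolutionOf (D h) := by
    intro h s hs
    obtain ⟨h1, h2, h3⟩ := (hiff _ _).1 hs
    exact solution_unique hκpos hρ0 hμ0 hr0 hκ0 h1 h2 (evolutionOf_deriv _)
      (evolutionOf_deriv_fn _) (h3.trans (hD h).symm)
  -- A weak solution exists, so `Classical.epsilon` returns one, and uniqueness identifies it.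
  have hsol : ∀ h, solution ℓ T ρ μ r κ (prim ℝ T h) = evolutionOf (D h) := fun h =>
    huniq h _ (Classical.epsilon_spec ⟨_, hex h⟩)
  have hrep := fun h => exists_contRep_dxx hκpos hrc hκc hr0 hκc0 (D h) _
    (moment_eq (mρ := mρ) (mμ := mμ) D h (hD h))
  have hPhi : ∀ h, Phi ℓ T ρ μ r κ (prim ℝ T h) =ᵐ[volume.restrict (Ioo 0 T)]
      ((innerSL ℝ (tipL2 ℓ)).compLpL 2 (volume.restrict (Ioo 0 T)) ∘L
        prim (L2 ℓ) T ∘L prim (L2 ℓ) T ∘L D) h := fun h => by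
    unfold Phi
    rw [hsol]
    exact tip_trace_ae_eq hℓ (D h)
  -- The moment at `0` is `⟨1, q⟩`, so `Ψ` is the bounded linear map `h ↦ -⟨1, q⟩`, although the
  -- individual traces in its definition are not controlled by the `L²` norm.
  have hPsi : ∀ h, Psi ℓ T ρ μ r κ (prim ℝ T h) =ᵐ[volume.restrict (Ioo 0 T)]
      ((-innerSL ℝ (oneL2 ℓ)).compLpL 2 (volume.restrict (Ioo 0 T)) ∘L shearOp mρ mμ D) h :=
      fun h => by
    filter_upwards [hrep h, (-innerSL ℝ (oneL2 ℓ)).coeFn_compLpL (p := 2)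
      (μ := volume.restrict (Ioo 0 T)) (shearOp mρ mμ D h)] with t ⟨F, G, hF, hG, hFG⟩ h2
    rw [ContinuousLinearMap.comp_apply, h2, Psi, hsol, trace_eq hℓ hF ⟨le_rfl, hℓ.le⟩,
      trace_eq hℓ hG ⟨le_rfl, hℓ.le⟩, hr00, hκ00, hFG]
    rfl
  refine ⟨fun g hg => ?_, exists_isMinOn_admissible hC _ ν _ hPhi,
    exists_isMinOn_admissible hC _ ω _ hPsi⟩
  rw [admissible_eq hC] at hg
  obtain ⟨h, -, rfl⟩ := hg
  refine ⟨⟨_, hex h, huniq h⟩, ?_, (Lp.memLp _).ae_eq (hPhi h).symm,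
    (Lp.memLp _).ae_eq (hPsi h).symm⟩
  rw [hsol]
  filter_upwards [hrep h] with t ⟨F, G, hF, hG, _⟩
  exact ⟨⟨_, isContRep_fn _⟩, ⟨F, hF⟩, ⟨G, hG⟩⟩
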